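/- A hypergraph $G$ has a finite vertex set $V(G)$ and a set $E(G)$ of subsets of $V(G)$, its edges; it is $k$-uniform if $|e|=k$ for every $e\in E(G)$. The degree $d_v$ of a vertex $v$ is the number of edges that contain $v$. For a $k$-uniform hypergraph $G$ with $V(G)=\{v_1,\dots,v_n\}$, $k\ge 2$, and $0\le\alpha<1$, let $\mathcal{A}_\alpha(G)=\alpha\mathcal{D}(G)+(1-\alpha)\mathcal{A}(G)$. Here $\mathcal{A}(G)$ is the tensor of order $k$ and dimension $n$ whose $(i_1,\dots,i_k)$-entry is $\frac{1}{(k-1)!}$ if $\{v_{i_1},\dots,v_{i_k}\}\in E(G)$ and $0$ otherwise, and $\mathcal{D}(G)$ is the diagonal tensor of order $k$ whose $(i,\dots,i)$-entry is $d_{v_i}$. A complex number $\lambda$ is an eigenvalue of a tensor $\mathcal{T}$ of order $k$ and dimension $n$ if there is a nonzero $x\in\mathbb{C}^n$ with $\sum_{i_2,\dots,i_k=1}^n\mathcal{T}_{ii_2\dots i_k}x_{i_2}\cdots x_{i_k}=\lambda x_i^{k-1}$ for all $i$. The $\alpha$-spectral radius $\rho_\alpha(G)$ is the largest modulus of an eigenvalue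 of $\mathcal{A}_\alpha(G)$. A walk in $G$ is a sequence $(v_0,e_1,v_1,\dots,e_s,v_s)$ of vertices $v_i$ and edges $e_i$ with $v_{i-1},v_i\in e_i$ and $v_{i-1}\neq v_i$ for $i=1,\dots,s$; it is a path if all $v_i$ are distinct and all $e_i$ are distinct. A cycle is a walk with $s\ge 2$, all $e_i$ distinct, and all $v_i$ distinct except $v_0=v_s$; sequences that differ only in the starting vertex and the direction of traversal are the same cycle. $G$ is connected if any two vertices are joined by a path. A $k$-uniform hypercactus is a connected $k$-uniform hypergraph in which any two different cycles have at most one vertex in common, where the vertices of a cycle are all the vertices of $e_1\cup\dots\cup e_s$. Let $k\ge 2$, $m\ge 2$ and $0\le r\le\lfloor\frac m2\rfloor$, and assume $k\ge 3$ if $r\ge 1$. Let $H_{m,r,k}$ be the $k$-uniform hypergraph with $m$ edges that consists of $r$ cycles of length $2$ (pairs of edges that share exactly two vertices) and $m-2r$ further (pendant) edges, all through one common vertex $w$ and otherwise disjoint: apart from $w$ and, for each of the $r$ cycles, the second common vertex of its two edges, every vertex lies in exactly one edge. Theorem. Let $G$ be a $k$-uniform hypercactus with $m$ edges and exactly $r$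 cycles, and let $0\le\alpha<1$. Then $$\rho_\alpha(G)\le\rho_\alpha(H_{m,r,k}),$$ with equality if and only if $G\cong H_{m,r,k}$. -/

import Mathlib

/-! ### Tensors and their spectral radius -/

/-- A complex tensor of order `k` (with `k ≥ 1`) and dimension `|ι|`, indexed by `ι`: the entry
`T_{i i₂ … i_k}` is `T i j`, where `j = (i₂, …, i_k)` collects the last `k - 1` indices. -/
def Tensor (k : ℕ) (ι : Type*) : Type _ := ι → (Fin (k - 1) → ι) → ℂ

namespace Tensor

variable {k : ℕ} {ι : Type*} [Fintype ι]

/-- The vector `T x`, `(T x)_i = ∑_{i₂, …, i_k} T_{i i₂ … i_k} x_{i₂} ⋯ x_{i_k}`. -/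
noncomputable def mulVec (T : Tensor k ι) (x : ι → ℂ) (i : ι) : ℂ :=
  ∑ j : Fin (k - 1) → ι, T i j * ∏ t, x (j t)

/-- `μ` is an eigenvalue of `T`: `T x = μ x^{[k-1]}` for some nonzero complex vector `x`. -/
def IsEigenvalue (T : Tensor k ι) (μ : ℂ) : Prop :=
  ∃ x : ι → ℂ, x ≠ 0 ∧ ∀ i, T.mulVec x i = μ * x i ^ (k - 1)

/-- The spectral radius: the largest modulus of an eigenvalue. -/
noncomputable def spectralRadius (T : Tensor k ι) : ℝ :=
  sSup {ρ : ℝ | ∃ μ : ℂ, T.IsEigenvalue μ ∧ ρ = ‖μ‖}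

end Tensor

namespace Hypergraph

variable {V : Type*}

/-! ### The `α`-spectral radius of a uniform hypergraph -/

/-- Every edge has exactly `k` vertices. -/
def IsUniform (G : Hypergraph V) (k : ℕ) : Prop :=
  ∀ e ∈ G.edgeSet, e.ncard = k

/-- The degree of a vertex: the number of edges that contain it. -/
noncomputable def degree (G : Hypergraph V) (v : V) : ℕ :=
  {e | e ∈ G.edgeSet ∧ v ∈ e}.ncard

open Classical in
/-- The adjacency tensor of order `k`: the `(i₁, …, i_k)`-entry is `1 / (k-1)!` if
`{i₁, …, i_k}` is an edge, and `0` otherwise. -/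
noncomputable def adjacencyTensor (G : Hypergraph V) (k : ℕ) : Tensor k G.vertexSet :=
  fun i j =>
    if insert (i : V) (Set.range fun t => (j t : V)) ∈ G.edgeSet then
      1 / (Nat.factorial (k - 1) : ℂ)
    else 0

open Classical in
/-- The degree tensor of order `k`: diagonal, with the degrees on the diagonal. -/
noncomputable def degreeTensor (G : Hypergraph V) (k : ℕ) : Tensor k G.vertexSet :=
  fun i j => if ∀ t, j t = i then (G.degree i : ℂ) else 0

/-- The tensor `𝒜_α(G) = α 𝒟(G) + (1 - α) 𝒜(G)`. -/
noncomputable def alphaTensor (G : Hypergraph V) (k : ℕ) (α : ℝ) : Tensor k G.vertexSet :=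
  fun i j => (α : ℂ) * G.degreeTensor k i j + (1 - (α : ℂ)) * G.adjacencyTensor k i j

/-- The `α`-spectral radius `ρ_α(G)` of a `k`-uniform hypergraph. -/
noncomputable def alphaSpectralRadius (G : Hypergraph V) [Fintype G.vertexSet] (k : ℕ) (α : ℝ) :
    ℝ :=
  (G.alphaTensor k α).spectralRadius

/-! ### Walks, paths, cycles and hypercacti -/

/-- A walk `(v₀, e₁, v₁, …, e_s, v_s)`, where `edge i` (for `i < s`) is the edge `e_{i+1}`, which
contains the two distinct vertices `v_i` and `v_{i+1}`. -/
structure Walk (G : Hypergraph V) where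
  length : ℕ
  vert : Fin (length + 1) → V
  edge : Fin length → Set V
  vert_mem : ∀ i, vert i ∈ G.vertexSet
  edge_mem : ∀ i, edge i ∈ G.edgeSet
  left_mem : ∀ i, vert i.castSucc ∈ edge i
  right_mem : ∀ i, vert i.succ ∈ edge i
  vert_ne : ∀ i : Fin length, vert i.castSucc ≠ vert i.succ

namespace Walk

variable {G : Hypergraph V}

/-- A path: all vertices are distinct and all edges are distinct. -/
def IsPath (W : G.Walk) : Prop :=
  Function.Injective W.vert ∧ Function.Injective W.edge

/-- A cycle: at least two edges, all edges distinct, and all vertices distinct except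
`v₀ = v_s`. -/
def IsCycle (W : G.Walk) : Prop :=
  2 ≤ W.length ∧ Function.Injective W.edge ∧ W.vert 0 = W.vert (Fin.last W.length) ∧
    Function.Injective fun i : Fin W.length => W.vert i.castSucc

/-- The set of pairs (vertex, edge) that are consecutive in the walk. Two closed sequences that are
cycles differ only in the starting vertex and the direction of traversal if and only if they have
the same set of such pairs. -/
def incidences (W : G.Walk) : Set (V × Set V) :=
  (Set.range fun i => (W.vert i.castSucc, W.edge i)) ∪
    Set.range fun i => (W.vert i.succ, W.edge i)

/-- The walk (of positive length) viewed as a hypergraph: its edges are the `e_i`, its vertices are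
all the vertices of these edges. -/
def toHypergraph (W : G.Walk) : Hypergraph V where
  vertexSet := ⋃ i, W.edge i
  edgeSet := Set.range W.edge
  subset_vertexSet_of_mem_edgeSet' := by
    rintro _ ⟨i, rfl⟩
    exact Set.subset_iUnion W.edge i

end Walk

/-- Any two vertices are joined by a path. -/
def IsConnected (G : Hypergraph V) : Prop :=
  ∀ u ∈ G.vertexSet, ∀ v ∈ G.vertexSet,
    ∃ W : G.Walk, W.IsPath ∧ W.vert 0 = u ∧ W.vert (Fin.last W.length) = v

/-- The cycles of `G`, each one given by its incidences, so that sequences that differ only in the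
starting vertex and the direction of traversal count as one cycle. -/
def cycles (G : Hypergraph V) : Set (Set (V × Set V)) :=
  {I | ∃ W : G.Walk, W.IsCycle ∧ W.incidences = I}

/-- A `k`-uniform hypercactus: a connected `k`-uniform hypergraph in which any two different
cycles, viewed as hypergraphs, have at most one vertex in common. -/
structure IsHypercactus (G : Hypergraph V) (k : ℕ) : Prop where
  uniform : G.IsUniform k
  connected : G.IsConnected
  inter_subsingleton : ∀ C C' : G.Walk, C.IsCycle → C'.IsCycle → C.incidences ≠ C'.incidences →
    (C.toHypergraph.vertexSet ∩ C'.toHypergraph.vertexSet).Subsingleton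

/-- Isomorphism of hypergraphs: a bijection of the vertex sets under which the edges of `G`
correspond to the edges of `H`. -/
def IsIsomorphic {W : Type*} (G : Hypergraph V) (H : Hypergraph W) : Prop :=
  ∃ φ : G.vertexSet ≃ H.vertexSet, ∀ e : Set G.vertexSet,
    Subtype.val '' e ∈ G.edgeSet ↔ Subtype.val '' (φ '' e) ∈ H.edgeSet

/-! ### The hypergraph `H_{m,r,k}` -/

/-- The vertices of `H_{m,r,k}`: the vertex `center` common to all edges; for each of the `r` cycles
of length `2` the second common vertex `joint i` of its two edges, and the `k - 2` further vertices
of each of these two edges; the `k - 1` further vertices of each of the `m - 2 r` pendant edges. -/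
inductive ExtremalVertex (m r k : ℕ) : Type
  | center
  | joint (i : Fin r)
  | onCycle (i : Fin r) (s : Fin 2) (t : Fin (k - 2))
  | pendant (j : Fin (m - 2 * r)) (t : Fin (k - 1))
  deriving Fintype

/-- The hypergraph `H_{m,r,k}` (for `2 r ≤ m`, `k ≥ 2`, and `k ≥ 3` if `r ≥ 1`): `r` cycles of
length `2` and `m - 2 r` pendant edges, all through one common vertex, and otherwise disjoint. -/
def extremal (m r k : ℕ) : Hypergraph (ExtremalVertex m r k) where
  vertexSet := Set.univ
  edgeSet :=
    (Set.range fun p : Fin r × Fin 2 =>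
      {.center, .joint p.1} ∪ Set.range (ExtremalVertex.onCycle p.1 p.2)) ∪
    Set.range fun j : Fin (m - 2 * r) => {.center} ∪ Set.range (ExtremalVertex.pendant j)
  subset_vertexSet_of_mem_edgeSet' := fun _ _ => Set.subset_univ _

instance (m r k : ℕ) : Fintype (extremal m r k).vertexSet :=
  inferInstanceAs (Fintype (Set.univ : Set (ExtremalVertex m r k)))

end Hypergraph

open Finset

/-! ### A weighted inequality between the arithmetic and the geometric mean -/

/-! The bound comes from edge weights instead of a Perron vector. Suppose positive numbers B(v,e), v
∈ e, have product at least 1 over every edge, and Σ_{e∋v} (α + (1-α) B(v,e)) ≤ l at every vertex.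
Take moduli in an eigenvalue equation, multiply by |x_v|, sum over v and apply AM-GM on each edge:
every eigenvalue has modulus at most l (`le_of_edge_weights`). For connected G, one product above 1
makes this strict (`lt_of_edge_weights`).

Put a = α/(1-α) and l = α + (1-α)b = (1-α)(a+b). Distribute a mass over the edges: each edge
receives a + 1/b^(k-1), and each cycle a further 4/(b^(k-2)(b-a)) - 2/b^(k-1), spread evenly over
its edges. Requiring total mass a+b is an equation for b that involves G only through m and r;
`exists_extremal_parameter` solves it. The branch of e at v consists of the edges linked to e
outside v, and B(v,e) is its mass, divided by the number of its edges at v, minus a. The vertex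
condition is then a double count (`sum_branch_div_le`). For the product, note that an edge is
missing from the branch of e at no more than one vertex of e, and that edges on a common cycle with
e are missing nowhere. So the missing masses sum to at most the mass outside e, or outside its
cycle, and ∏(1-y_i) ≥ 1-Σy_i gives product at least 1 (`one_le_prod_branch`). The masses are
calibrated so that this is sharp when everything else hangs at one vertex of e and any cycle through
e has length 2.

If ρ_α(G) = l, every edge is in this sharp situation (`IsTight`); then all edges share a vertex
(`IsHypercactus.exists_center`) and G is extremal (`IsHypercactus.isIsomorphic_extremal`). An
explicit positive eigenvector gives l ≤ ρ_α(H) (`le_alphaSpectralRadius_extremal`), which is all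
that is needed about H. -/

theorem rpow_prod_mul_prod_le_sum {ι : Type*} {s : Finset ι} {k : ℕ} (hs : s.card = k)
    (hk : 0 < k) {B x : ι → ℝ} (hB : ∀ i ∈ s, 0 ≤ B i) (hx : ∀ i ∈ s, 0 ≤ x i) :
    (k : ℝ) * ((∏ i ∈ s, B i) ^ (1 / (k : ℝ)) * ∏ i ∈ s, x i) ≤ ∑ i ∈ s, B i * x i ^ k := by
  have hk' : (0 : ℝ) < k := by exact_mod_cast hk
  -- AM-GM for the `k` numbers `B i * x i ^ k`, with equal weights `1 / k`.
  have h := Real.geom_mean_le_arith_mean_weighted s (fun _ => 1 / (k : ℝ))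
    (fun i => B i * x i ^ k) (fun _ _ => by positivity)
    (by rw [sum_const, hs, nsmul_eq_mul]; field_simp)
    (fun i hi => mul_nonneg (hB i hi) (pow_nonneg (hx i hi) k))
  rw [← mul_sum] at h
  have h2 : ∏ i ∈ s, (B i * x i ^ k) ^ (1 / (k : ℝ))
      = (∏ i ∈ s, B i) ^ (1 / (k : ℝ)) * ∏ i ∈ s, x i := by
    rw [← Real.finsetProd_rpow s B hB, ← prod_mul_distrib]
    refine prod_congr rfl fun i hi => ?_
    rw [Real.mul_rpow (hB i hi) (pow_nonneg (hx i hi) k), one_div,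
      Real.pow_rpow_inv_natCast (hx i hi) hk.ne']
  rw [h2] at h
  calc _ ≤ (k : ℝ) * (1 / (k : ℝ) * ∑ i ∈ s, B i * x i ^ k) := by gcongr
    _ = _ := by field_simp

theorem card_mul_prod_le_sum {ι : Type*} {s : Finset ι} {k : ℕ} (hs : s.card = k)
    (hk : 0 < k) {B x : ι → ℝ} (hB : ∀ i ∈ s, 0 ≤ B i) (hx : ∀ i ∈ s, 0 ≤ x i)
    (hP : 1 ≤ ∏ i ∈ s, B i) :
    (k : ℝ) * ∏ i ∈ s, x i ≤ ∑ i ∈ s, B i * x i ^ k := by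
  refine le_trans ?_ (rpow_prod_mul_prod_le_sum hs hk hB hx)
  have h1 : (1 : ℝ) ≤ (∏ i ∈ s, B i) ^ (1 / (k : ℝ)) := Real.one_le_rpow hP (by positivity)
  have h2 : 0 ≤ ∏ i ∈ s, x i := prod_nonneg hx
  gcongr
  nlinarith

theorem card_mul_prod_lt_sum {ι : Type*} {s : Finset ι} {k : ℕ} (hs : s.card = k)
    (hk : 0 < k) {B x : ι → ℝ} (hB : ∀ i ∈ s, 0 ≤ B i) (hx : ∀ i ∈ s, 0 < x i)
    (hP : 1 < ∏ i ∈ s, B i) :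
    (k : ℝ) * ∏ i ∈ s, x i < ∑ i ∈ s, B i * x i ^ k := by
  have hk' : (0 : ℝ) < k := by exact_mod_cast hk
  refine lt_of_lt_of_le ?_ (rpow_prod_mul_prod_le_sum hs hk hB fun i hi => (hx i hi).le)
  have h1 : (1 : ℝ) < (∏ i ∈ s, B i) ^ (1 / (k : ℝ)) := Real.one_lt_rpow hP (by positivity)
  have h2 : 0 < ∏ i ∈ s, x i := prod_pos hx
  gcongr
  nlinarith

/-! ### Bounds for the eigenvalues in terms of edge weights -/

section Weights

variable {ι ε : Type*} [Fintype ι] [Fintype ε] [DecidableEq ι]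

theorem sum_sum_filter_mem (vs : ε → Finset ι) (F : ι → ε → ℝ) :
    ∑ i, ∑ e with i ∈ vs e, F i e = ∑ e, ∑ i ∈ vs e, F i e := by
  simp_rw [sum_filter]
  rw [sum_comm]
  refine sum_congr rfl fun e _ => ?_
  rw [← sum_filter]
  congr 1
  ext i
  simp

variable {k : ℕ} {vs : ε → Finset ι} {α M l : ℝ} {x : ι → ℝ} {B : ι → ε → ℝ}

/-- Multiply `hM` at `i` by `x i` and sum over `i`: the product over an edge then appears once for
each of its `k` vertices. The left side collects the AM-GM defects of the edges, so its sign decides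
between `M` and `l`. -/
theorem weighted_excess_le (hk : 0 < k) (hvs : ∀ e, (vs e).card = k)
    (hx : ∀ i, 0 ≤ x i)
    (hM : ∀ i, M * x i ^ (k - 1) ≤ α * (#{e | i ∈ vs e} : ℝ) * x i ^ (k - 1) +
      (1 - α) * ∑ e with i ∈ vs e, ∏ u ∈ (vs e).erase i, x u)
    (hl : ∀ i, ∑ e with i ∈ vs e, (α + (1 - α) * B i e) ≤ l) :
    (1 - α) * ∑ e, (∑ i ∈ vs e, B i e * x i ^ k - k * ∏ u ∈ vs e, x u) ≤
      (l - M) * ∑ i, x i ^ k := by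
  have h1 : M * ∑ i, x i ^ k ≤
      ∑ i, ∑ e with i ∈ vs e, (α * x i ^ k + (1 - α) * ∏ u ∈ vs e, x u) := by
    rw [mul_sum]
    refine sum_le_sum fun i _ => ?_
    have h := mul_le_mul_of_nonneg_right (hM i) (hx i)
    have e1 : x i ^ k = x i ^ (k - 1) * x i := by rw [← pow_succ]; congr 1; omega
    have e2 : (∑ e with i ∈ vs e, ∏ u ∈ (vs e).erase i, x u) * x i
        = ∑ e with i ∈ vs e, ∏ u ∈ vs e, x u := by
      rw [sum_mul]
      refine sum_congr rfl fun e he => ?_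
      exact prod_erase_mul _ _ (mem_filter.1 he).2
    rw [sum_add_distrib, sum_const, nsmul_eq_mul, ← mul_sum, ← e2, e1]
    linarith
  have h2 : ∑ i, ∑ e with i ∈ vs e, (α + (1 - α) * B i e) * x i ^ k ≤ l * ∑ i, x i ^ k := by
    rw [mul_sum]
    refine sum_le_sum fun i _ => ?_
    rw [← sum_mul]
    exact mul_le_mul_of_nonneg_right (hl i) (pow_nonneg (hx i) k)
  rw [sum_sum_filter_mem vs (fun i e => α * x i ^ k + (1 - α) * ∏ u ∈ vs e, x u)] at h1
  rw [sum_sum_filter_mem vs (fun i e => (α + (1 - α) * B i e) * x i ^ k)] at h2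
  have h3 : (1 - α) * ∑ e, (∑ i ∈ vs e, B i e * x i ^ k - k * ∏ u ∈ vs e, x u) =
      ∑ e, ∑ i ∈ vs e, (α + (1 - α) * B i e) * x i ^ k -
      ∑ e, ∑ i ∈ vs e, (α * x i ^ k + (1 - α) * ∏ u ∈ vs e, x u) := by
    rw [← sum_sub_distrib, mul_sum]
    refine sum_congr rfl fun e _ => ?_
    rw [← sum_sub_distrib, mul_sub]
    have : ∀ i ∈ vs e, (α + (1 - α) * B i e) * x i ^ k -
        (α * x i ^ k + (1 - α) * ∏ u ∈ vs e, x u) =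
        (1 - α) * (B i e * x i ^ k) - (1 - α) * ∏ u ∈ vs e, x u := fun i _ => by ring
    rw [sum_congr rfl this, sum_sub_distrib, sum_const, hvs, nsmul_eq_mul, mul_sum]
    ring
  rw [h3]
  linarith

theorem le_of_edge_weights (hα₁ : α < 1) (hk : 0 < k) (hvs : ∀ e, (vs e).card = k)
    (hx : ∀ i, 0 ≤ x i) (hx0 : x ≠ 0)
    (hM : ∀ i, M * x i ^ (k - 1) ≤ α * (#{e | i ∈ vs e} : ℝ) * x i ^ (k - 1) +
      (1 - α) * ∑ e with i ∈ vs e, ∏ u ∈ (vs e).erase i, x u)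
    (hB : ∀ e, ∀ i ∈ vs e, 0 < B i e)
    (hl : ∀ i, ∑ e with i ∈ vs e, (α + (1 - α) * B i e) ≤ l)
    (hP : ∀ e, 1 ≤ ∏ i ∈ vs e, B i e) : M ≤ l := by
  have h := weighted_excess_le hk hvs hx hM hl
  have h0 : 0 < ∑ i, x i ^ k := by
    obtain ⟨i, hi⟩ := Function.ne_iff.1 hx0
    exact sum_pos' (fun i _ => pow_nonneg (hx i) k)
      ⟨i, mem_univ i, pow_pos (lt_of_le_of_ne (hx i) (Ne.symm hi)) k⟩
  have h1 : 0 ≤ ∑ e, (∑ i ∈ vs e, B i e * x i ^ k - k * ∏ u ∈ vs e, x u) :=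
    sum_nonneg fun e _ => sub_nonneg.2 <|
      card_mul_prod_le_sum (hvs e) hk (fun i hi => (hB e i hi).le) (fun i _ => hx i) (hP e)
  have h2 := (mul_nonneg (sub_nonneg.2 hα₁.le) h1).trans h
  exact sub_nonneg.1 (nonneg_of_mul_nonneg_left h2 h0)

theorem lt_of_edge_weights (hα₁ : α < 1) (hk : 0 < k) (hvs : ∀ e, (vs e).card = k)
    (hx : ∀ i, 0 ≤ x i) (hx0 : x ≠ 0)
    (hM : ∀ i, M * x i ^ (k - 1) ≤ α * (#{e | i ∈ vs e} : ℝ) * x i ^ (k - 1) +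
      (1 - α) * ∑ e with i ∈ vs e, ∏ u ∈ (vs e).erase i, x u)
    (hB : ∀ e, ∀ i ∈ vs e, 0 < B i e)
    (hl : ∀ i, ∑ e with i ∈ vs e, (α + (1 - α) * B i e) ≤ l)
    (hP : ∀ e, 1 ≤ ∏ i ∈ vs e, B i e) (hP' : ∃ e, 1 < ∏ i ∈ vs e, B i e)
    (hconn : ∀ s : Set ι, s.Nonempty →
      (∀ e, ∀ u ∈ vs e, u ∈ s → ∀ v ∈ vs e, v ∈ s) → s = Set.univ) : M < l := by
  refine lt_of_le_of_ne (le_of_edge_weights hα₁ hk hvs hx hx0 hM hB hl hP) fun hMl => ?_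
  have h := weighted_excess_le hk hvs hx hM hl
  rw [hMl, sub_self, zero_mul] at h
  have hnn : ∀ e ∈ (univ : Finset ε), 0 ≤ ∑ i ∈ vs e, B i e * x i ^ k - k * ∏ u ∈ vs e, x u :=
    fun e _ => sub_nonneg.2 <|
      card_mul_prod_le_sum (hvs e) hk (fun i hi => (hB e i hi).le) (fun i _ => hx i) (hP e)
  have hzero := (sum_eq_zero_iff_of_nonneg hnn).1
    (le_antisymm (nonpos_of_mul_nonpos_right h (sub_pos.2 hα₁)) (sum_nonneg hnn))
  -- With zero defect on every edge, a zero of `x` on an edge kills the product and hence all terms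
  -- `B i e * x i ^ k` of that edge. The support is therefore closed under edges.
  have hsupp : {i | x i ≠ 0} = Set.univ := by
    refine hconn _ (Function.ne_iff.1 hx0) fun e u hu hxu v hv hxv => ?_
    have h1 := hzero e (mem_univ e)
    rw [prod_eq_zero hv hxv, mul_zero, sub_zero] at h1
    have h2 := (sum_eq_zero_iff_of_nonneg
      fun i hi => mul_nonneg (hB e i hi).le (pow_nonneg (hx i) k)).1 h1 u hu
    rcases mul_eq_zero.1 h2 with h3 | h3
    · exact (hB e u hu).ne' h3
    · exact hxu (pow_eq_zero_iff hk.ne' |>.1 h3)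
  obtain ⟨e, he⟩ := hP'
  have hpos : ∀ i, 0 < x i := fun i => by
    have : i ∈ {i | x i ≠ 0} := hsupp ▸ Set.mem_univ i
    exact lt_of_le_of_ne (hx i) (Ne.symm this)
  exact (sub_pos.2 (card_mul_prod_lt_sum (hvs e) hk (fun i hi => (hB e i hi).le)
    (fun i _ => hpos i) he)).ne' (hzero e (mem_univ e))

end Weights

/-! ### The spectral radius of a tensor -/

namespace Tensor

variable {k : ℕ} {ι : Type*} [Fintype ι]

theorem mulVec_smul (T : Tensor k ι) (c : ℂ) (x : ι → ℂ) (i : ι) :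
    T.mulVec (c • x) i = c ^ (k - 1) * T.mulVec x i := by
  simp only [mulVec, mul_sum, Pi.smul_apply, smul_eq_mul, prod_mul_distrib, prod_const,
    card_univ, Fintype.card_fin]
  exact sum_congr rfl fun j _ => by ring

theorem continuous_mulVec (T : Tensor k ι) (i : ι) : Continuous fun x : ι → ℂ => T.mulVec x i := by
  unfold mulVec
  fun_prop

theorem IsEigenvalue.exists_norm_eq_one {T : Tensor k ι} {μ : ℂ} (h : T.IsEigenvalue μ) :
    ∃ x : ι → ℂ, ‖x‖ = 1 ∧ ∀ i, T.mulVec x i = μ * x i ^ (k - 1) := by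
  obtain ⟨x, hx0, hx⟩ := h
  refine ⟨((‖x‖⁻¹ : ℝ) : ℂ) • x, ?_, fun i => ?_⟩
  · rw [norm_smul, Complex.norm_real, norm_inv, norm_norm, inv_mul_cancel₀ (norm_ne_zero_iff.2 hx0)]
  · rw [mulVec_smul, hx, Pi.smul_apply, smul_eq_mul, mul_pow]
    ring

/-- Normalised eigenpairs form a closed bounded set. Hence the supremum is attained, which strict
bounds on the eigenvalues need in order to pass to the spectral radius. -/
theorem isCompact_norm_eigenvalues (T : Tensor k ι) {R : ℝ}
    (hR : ∀ μ, T.IsEigenvalue μ → ‖μ‖ ≤ R) :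
    IsCompact {ρ : ℝ | ∃ μ : ℂ, T.IsEigenvalue μ ∧ ρ = ‖μ‖} := by
  have hK : IsCompact {p : ℂ × (ι → ℂ) | ‖p.1‖ ≤ R ∧ ‖p.2‖ = 1 ∧
      ∀ i, T.mulVec p.2 i = p.1 * p.2 i ^ (k - 1)} := by
    refine Metric.isCompact_of_isClosed_isBounded ?_ ?_
    · simp only [Set.ofPred_and, Set.ofPred_forall]
      refine (isClosed_le (continuous_fst.norm) continuous_const).inter
        ((isClosed_eq (continuous_snd.norm) continuous_const).inter ?_)
      exact isClosed_iInter fun i =>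
        isClosed_eq ((T.continuous_mulVec i).comp continuous_snd) (by fun_prop)
    · refine (Metric.isBounded_closedBall (x := (0 : ℂ)) (r := R)).prod
        (Metric.isBounded_closedBall (x := (0 : ι → ℂ)) (r := 1)) |>.subset ?_
      rintro ⟨μ, x⟩ ⟨h1, h2, -⟩
      simp [h1, h2.le]
  convert hK.image (f := fun p => ‖p.1‖) (by fun_prop) using 1
  ext ρ
  constructor
  · rintro ⟨μ, hμ, rfl⟩
    obtain ⟨x, hx1, hx⟩ := hμ.exists_norm_eq_one
    exact ⟨(μ, x), ⟨hR μ hμ, hx1, hx⟩, rfl⟩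
  · rintro ⟨⟨μ, x⟩, ⟨-, h1, h2⟩, rfl⟩
    exact ⟨μ, ⟨x, fun h => by simp [h] at h1, h2⟩, rfl⟩

theorem spectralRadius_le (T : Tensor k ι) {R : ℝ} (hR0 : 0 ≤ R)
    (hR : ∀ μ, T.IsEigenvalue μ → ‖μ‖ ≤ R) : T.spectralRadius ≤ R :=
  Real.sSup_le (by rintro _ ⟨μ, hμ, rfl⟩; exact hR μ hμ) hR0

theorem spectralRadius_lt (T : Tensor k ι) {R : ℝ} (hR0 : 0 < R)
    (hR : ∀ μ, T.IsEigenvalue μ → ‖μ‖ < R) : T.spectralRadius < R := by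
  unfold spectralRadius
  -- If there were no eigenvalue, `sSup ∅ = 0` and positivity of `R` would suffice; existence of
  -- eigenvalues is thus never needed here.
  rcases Set.eq_empty_or_nonempty {ρ : ℝ | ∃ μ : ℂ, T.IsEigenvalue μ ∧ ρ = ‖μ‖} with h | h
  · rw [h, Real.sSup_empty]
    exact hR0
  · obtain ⟨μ, hμ, h⟩ := (T.isCompact_norm_eigenvalues fun μ hμ => (hR μ hμ).le).sSup_mem h
    rw [h]
    exact hR μ hμ

/-- Compare both sides at a coordinate of maximal modulus. This crude bound only serves to make the
supremum meaningful. -/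
theorem IsEigenvalue.norm_le {T : Tensor k ι} {μ : ℂ} (h : T.IsEigenvalue μ) :
    ‖μ‖ ≤ ∑ i, ∑ j, ‖T i j‖ := by
  obtain ⟨x, hx1, hx⟩ := h.exists_norm_eq_one
  have hle : ∀ i, ‖x i‖ ≤ 1 := fun i => hx1 ▸ norm_le_pi_norm x i
  obtain ⟨i, hi⟩ : ∃ i, ‖x i‖ = 1 := by
    by_contra! hne
    have : ‖x‖ < 1 := (pi_norm_lt_iff one_pos).2 fun i => lt_of_le_of_ne (hle i) (hne i)
    exact this.ne hx1
  calc ‖μ‖ = ‖T.mulVec x i‖ := by rw [hx, norm_mul, norm_pow, hi, one_pow, mul_one]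
    _ ≤ ∑ j, ‖T i j * ∏ t, x (j t)‖ := norm_sum_le _ _
    _ ≤ ∑ j, ‖T i j‖ := by
        refine sum_le_sum fun j _ => ?_
        rw [norm_mul, norm_prod]
        exact mul_le_of_le_one_right (norm_nonneg _)
          (prod_le_one (fun _ _ => norm_nonneg _) fun t _ => hle _)
    _ ≤ ∑ i, ∑ j, ‖T i j‖ :=
        single_le_sum (f := fun i => ∑ j, ‖T i j‖)
          (fun _ _ => sum_nonneg fun _ _ => norm_nonneg _) (mem_univ i)

theorem IsEigenvalue.norm_le_spectralRadius {T : Tensor k ι} {μ : ℂ} (h : T.IsEigenvalue μ) :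
    ‖μ‖ ≤ T.spectralRadius :=
  le_csSup ⟨_, by rintro _ ⟨ν, hν, rfl⟩; exact hν.norm_le⟩ ⟨μ, h, rfl⟩

end Tensor

/-! ### The tensors of a uniform hypergraph in terms of its edges -/

/-- Such a tuple is the same as a bijection `Fin n ≃ s`. The resulting `n!` cancels the
normalisation of the adjacency tensor. -/
theorem card_filter_image_eq {ι : Type*} [Fintype ι] [DecidableEq ι] {n : ℕ} {s : Finset ι}
    (hs : s.card = n) : #{j : Fin n → ι | univ.image j = s} = n.factorial := by
  classical
  have e : Fin n ≃ s := (finCongr hs.symm).trans s.equivFin.symm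
  have h : ({j : Fin n → ι | univ.image j = s} : Finset _) =
      univ.image fun (φ : Fin n ≃ s) t => (φ t : ι) := by
    ext j
    simp only [mem_filter, mem_univ, true_and, mem_image]
    constructor
    · intro hj
      have hinj : Function.Injective j := by
        rw [← Set.injOn_univ, ← coe_univ, ← card_image_iff, hj, hs, card_univ, Fintype.card_fin]
      have hmem : ∀ t, j t ∈ s := fun t => hj ▸ mem_image_of_mem j (mem_univ t)
      refine ⟨Equiv.ofBijective (fun t => ⟨j t, hmem t⟩) ⟨fun a b hab => hinj ?_, fun u => ?_⟩, rfl⟩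
      · exact congrArg Subtype.val hab
      · have hu : (u : ι) ∈ univ.image j := hj.symm ▸ u.2
        obtain ⟨t, -, ht⟩ := mem_image.1 hu
        exact ⟨t, Subtype.ext ht⟩
    · rintro ⟨φ, rfl⟩
      ext u
      simp only [mem_image, mem_univ, true_and]
      exact ⟨by rintro ⟨t, rfl⟩; exact (φ t).2, fun hu => ⟨φ.symm ⟨u, hu⟩, by simp⟩⟩
  rw [h, card_image_of_injective, card_univ, Fintype.card_equiv e, Fintype.card_fin]
  intro φ ψ h
  ext t
  exact congrFun h t

theorem sum_filter_image_eq_prod {ι : Type*} [Fintype ι] [DecidableEq ι] {n : ℕ} {s : Finset ι}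
    (hs : s.card = n) (x : ι → ℂ) :
    ∑ j : Fin n → ι with univ.image j = s, ∏ t, x (j t) = n.factorial * ∏ u ∈ s, x u := by
  rw [← card_filter_image_eq hs, ← nsmul_eq_mul, ← sum_const]
  refine sum_congr rfl fun j hj => ?_
  have hj' := (mem_filter.1 hj).2
  have hinj : Function.Injective j := by
    rw [← Set.injOn_univ, ← coe_univ, ← card_image_iff, hj', hs, card_univ, Fintype.card_fin]
  rw [← hj', prod_image fun a _ b _ h => hinj h]

namespace Hypergraph

open Classical

variable {V : Type*} {G : Hypergraph V} {k : ℕ}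

theorem finite_edgeSet (G : Hypergraph V) [Finite G.vertexSet] : G.edgeSet.Finite :=
  (Set.toFinite G.vertexSet).powerset.subset fun _ he => G.subset_vertexSet_of_mem_edgeSet' he

noncomputable instance fintypeEdgeSet [Fintype G.vertexSet] : Fintype G.edgeSet :=
  G.finite_edgeSet.fintype

/-- The vertices of an edge, as a finite set of vertices of the hypergraph. -/
noncomputable def verts [Fintype G.vertexSet] (e : G.edgeSet) : Finset G.vertexSet :=
  {u | (u : V) ∈ (e : Set V)}

section

variable [Fintype G.vertexSet]

@[simp]
theorem mem_verts {e : G.edgeSet} {u : G.vertexSet} : u ∈ verts e ↔ (u : V) ∈ (e : Set V) := by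
  simp [verts]

theorem coe_image_verts (e : G.edgeSet) : Subtype.val '' (verts e : Set G.vertexSet) = e := by
  ext v
  constructor
  · rintro ⟨u, hu, rfl⟩
    exact mem_verts.1 hu
  · intro hv
    exact ⟨⟨v, G.subset_vertexSet_of_mem_edgeSet' e.2 hv⟩, mem_verts.2 hv, rfl⟩

theorem IsUniform.card_verts (hG : G.IsUniform k) (e : G.edgeSet) : (verts e).card = k := by
  rw [← hG e e.2, ← Set.ncard_coe_finset, ← Set.ncard_image_of_injective _ Subtype.val_injective,
    coe_image_verts]

theorem degree_eq_card (v : V) : G.degree v = #{e : G.edgeSet | v ∈ (e : Set V)} := by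
  rw [degree, ← Set.ncard_coe_finset, ← Set.ncard_image_of_injective _ Subtype.val_injective]
  congr 1
  ext e
  simp only [Set.mem_ofPred_eq, coe_filter, mem_univ, true_and, Set.mem_image, Subtype.exists,
    exists_and_right, exists_eq_right]
  tauto

/-- If `i` occurred among the `j t`, at most `k - 1` vertices would be available to fill an edge of
size `k`. -/
theorem IsUniform.insert_range_eq_iff (hG : G.IsUniform k) (hk : 2 ≤ k) (e : G.edgeSet)
    {i : G.vertexSet} (hi : (i : V) ∈ (e : Set V)) (j : Fin (k - 1) → G.vertexSet) :
    insert (i : V) (Set.range fun t => (j t : V)) = e ↔ univ.image j = (verts e).erase i := by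
  have h1 : insert (i : V) (Set.range fun t => (j t : V)) =
      Subtype.val '' ((insert i (univ.image j) : Finset _) : Set G.vertexSet) := by
    ext v
    simp [Set.image_insert_eq, ← Set.range_comp, Function.comp_def]
  rw [h1, ← coe_image_verts e, Set.image_eq_image Subtype.val_injective, coe_inj]
  constructor
  · intro h
    have hi' : i ∉ univ.image j := by
      intro hmem
      rw [insert_eq_self.2 hmem] at h
      have := card_image_le (s := univ) (f := j)
      rw [h, hG.card_verts, card_univ, Fintype.card_fin] at this
      omega
    rw [← h, erase_insert hi']
  · intro h
    rw [h, insert_erase (mem_verts.2 hi)]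

theorem IsUniform.mulVec_adjacencyTensor (hG : G.IsUniform k) (hk : 2 ≤ k)
    (x : G.vertexSet → ℂ) (i : G.vertexSet) :
    (G.adjacencyTensor k).mulVec x i =
      ∑ e : G.edgeSet with i ∈ verts e, ∏ u ∈ (verts e).erase i, x u := by
  have hfac : ((k - 1).factorial : ℂ) ≠ 0 := by exact_mod_cast Nat.factorial_ne_zero _
  -- A tensor entry becomes a sum over the edges at `i` with at most one nonzero term, so that the
  -- sums over `j` and over the edges can be exchanged.
  have h1 : ∀ j : Fin (k - 1) → G.vertexSet, G.adjacencyTensor k i j * ∏ t, x (j t) =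
      ∑ e : G.edgeSet with i ∈ verts e, if univ.image j = (verts e).erase i then
        1 / ((k - 1).factorial : ℂ) * ∏ t, x (j t) else 0 := by
    intro j
    unfold adjacencyTensor
    have hsum : ∀ e ∈ ({e | i ∈ verts e} : Finset G.edgeSet),
        (if univ.image j = (verts e).erase i then 1 / ((k - 1).factorial : ℂ) * ∏ t, x (j t)
          else 0) =
        if (insert (i : V) (Set.range fun t => (j t : V)) = e) then
          1 / ((k - 1).factorial : ℂ) * ∏ t, x (j t) else 0 := by
      intro e he
      simp only [hG.insert_range_eq_iff hk e (mem_verts.1 (mem_filter.1 he).2) j]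
    rw [sum_congr rfl hsum]
    split_ifs with h
    · rw [sum_eq_single ⟨_, h⟩]
      · simp
      · intro e _ he
        rw [if_neg]
        exact fun h' => he (Subtype.ext h'.symm)
      · intro hn
        exact (hn (mem_filter.2 ⟨mem_univ _, mem_verts.2 (Set.mem_insert _ _)⟩)).elim
    · rw [zero_mul, sum_eq_zero]
      intro e _
      rw [if_neg]
      intro h'
      exact h (h' ▸ e.2)
  unfold Tensor.mulVec
  rw [sum_congr rfl fun j _ => h1 j, sum_comm]
  refine sum_congr rfl fun e he => ?_
  rw [← sum_filter, ← mul_sum, sum_filter_image_eq_prod]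
  · field_simp
  · rw [card_erase_of_mem (mem_filter.1 he).2, hG.card_verts]

theorem mulVec_degreeTensor (x : G.vertexSet → ℂ) (i : G.vertexSet) :
    (G.degreeTensor k).mulVec x i = G.degree i * x i ^ (k - 1) := by
  unfold Tensor.mulVec degreeTensor
  rw [sum_eq_single fun _ => i]
  · simp
  · intro j _ hj
    rw [if_neg, zero_mul]
    exact fun h => hj (funext h)
  · simp

theorem IsUniform.mulVec_alphaTensor (hG : G.IsUniform k) (hk : 2 ≤ k) (α : ℝ)
    (x : G.vertexSet → ℂ) (i : G.vertexSet) :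
    (G.alphaTensor k α).mulVec x i = α * (#{e : G.edgeSet | i ∈ verts e} : ℂ) * x i ^ (k - 1) +
      (1 - α) * ∑ e : G.edgeSet with i ∈ verts e, ∏ u ∈ (verts e).erase i, x u := by
  rw [← hG.mulVec_adjacencyTensor hk, mul_assoc]
  have := mulVec_degreeTensor (G := G) (k := k) x i
  rw [degree_eq_card] at this
  simp only [mem_verts]
  rw [← this]
  unfold Tensor.mulVec alphaTensor
  rw [mul_sum, mul_sum, ← sum_add_distrib]
  exact sum_congr rfl fun j _ => by ring

theorem IsConnected.eq_univ (hG : G.IsConnected) {s : Set G.vertexSet} (hs : s.Nonempty)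
    (h : ∀ e : G.edgeSet, ∀ u ∈ verts e, u ∈ s → ∀ v ∈ verts e, v ∈ s) : s = Set.univ := by
  obtain ⟨u, hu⟩ := hs
  refine Set.eq_univ_of_forall fun v => ?_
  obtain ⟨W, -, h0, h1⟩ := hG u u.2 v v.2
  have key : ∀ n, ∀ hn : n < W.length + 1, (⟨W.vert ⟨n, hn⟩, W.vert_mem _⟩ : G.vertexSet) ∈ s := by
    intro n
    induction n with
    | zero =>
      intro hn
      have h0' : W.vert ⟨0, hn⟩ = u := h0
      simpa only [h0'] using hu
    | succ n ih =>
      intro hn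
      have hn' : n < W.length := by omega
      exact h ⟨W.edge ⟨n, hn'⟩, W.edge_mem _⟩ _ (mem_verts.2 (W.left_mem ⟨n, hn'⟩))
        (ih (by omega)) _ (mem_verts.2 (W.right_mem ⟨n, hn'⟩))
  have := key W.length (by omega)
  convert this
  exact h1.symm

/-- By the triangle inequality the moduli of a complex eigenvector satisfy the inequality required
by the edge-weight bounds; no Perron–Frobenius theory enters. -/
theorem IsUniform.norm_eigenvalue_le_apply (hG : G.IsUniform k) (hk : 2 ≤ k) {α : ℝ} (hα₀ : 0 ≤ α)
    (hα₁ : α < 1) {μ : ℂ} {x : G.vertexSet → ℂ}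
    (hx : ∀ i, (G.alphaTensor k α).mulVec x i = μ * x i ^ (k - 1)) (i : G.vertexSet) :
    ‖μ‖ * ‖x i‖ ^ (k - 1) ≤ α * (#{e : G.edgeSet | i ∈ verts e} : ℝ) * ‖x i‖ ^ (k - 1) +
      (1 - α) * ∑ e : G.edgeSet with i ∈ verts e, ∏ u ∈ (verts e).erase i, ‖x u‖ := by
  have h := congrArg norm (hx i)
  rw [norm_mul, norm_pow] at h
  rw [← h, hG.mulVec_alphaTensor hk]
  refine (norm_add_le _ _).trans ?_
  have e1 : ‖(1 - α : ℂ)‖ = 1 - α := by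
    rw [← Complex.ofReal_one, ← Complex.ofReal_sub, Complex.norm_real, Real.norm_eq_abs,
      abs_of_pos (sub_pos.2 hα₁)]
  rw [norm_mul, norm_mul, norm_mul, norm_pow, e1, Complex.norm_real, Real.norm_eq_abs,
    abs_of_nonneg hα₀, Complex.norm_natCast]
  have h2 : ‖∑ e : G.edgeSet with i ∈ verts e, ∏ u ∈ (verts e).erase i, x u‖ ≤
      ∑ e : G.edgeSet with i ∈ verts e, ∏ u ∈ (verts e).erase i, ‖x u‖ := by
    simp only [← norm_prod]
    exact norm_sum_le _ _
  have h3 := mul_le_mul_of_nonneg_left h2 (sub_nonneg.2 hα₁.le)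
  linarith

/-- Edge weights `B` that are at most `l` at every vertex and whose product over every edge is at
least `1` show that the `α`-spectral radius is at most `l`. -/
theorem IsUniform.alphaSpectralRadius_le (hG : G.IsUniform k) (hk : 2 ≤ k) {α l : ℝ} (hα₀ : 0 ≤ α)
    (hα₁ : α < 1) (hl0 : 0 ≤ l) {B : G.vertexSet → G.edgeSet → ℝ}
    (hB : ∀ e, ∀ i ∈ verts e, 0 < B i e)
    (hl : ∀ i, ∑ e : G.edgeSet with i ∈ verts e, (α + (1 - α) * B i e) ≤ l)
    (hP : ∀ e, 1 ≤ ∏ i ∈ verts e, B i e) : G.alphaSpectralRadius k α ≤ l := by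
  refine Tensor.spectralRadius_le _ hl0 ?_
  rintro μ ⟨x, hx0, hx⟩
  refine le_of_edge_weights (x := fun i => ‖x i‖) hα₁ (by omega) hG.card_verts
    (fun i => norm_nonneg _) ?_ (hG.norm_eigenvalue_le_apply hk hα₀ hα₁ hx) hB hl hP
  exact fun h => hx0 (funext fun i => norm_eq_zero.1 (congrFun h i))

theorem IsUniform.alphaSpectralRadius_lt (hG : G.IsUniform k) (hc : G.IsConnected) (hk : 2 ≤ k)
    {α l : ℝ} (hα₀ : 0 ≤ α) (hα₁ : α < 1) (hl0 : 0 < l) {B : G.vertexSet → G.edgeSet → ℝ}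
    (hB : ∀ e, ∀ i ∈ verts e, 0 < B i e)
    (hl : ∀ i, ∑ e : G.edgeSet with i ∈ verts e, (α + (1 - α) * B i e) ≤ l)
    (hP : ∀ e, 1 ≤ ∏ i ∈ verts e, B i e) (hP' : ∃ e, 1 < ∏ i ∈ verts e, B i e) :
    G.alphaSpectralRadius k α < l := by
  refine Tensor.spectralRadius_lt _ hl0 ?_
  rintro μ ⟨x, hx0, hx⟩
  refine lt_of_edge_weights (x := fun i => ‖x i‖) hα₁ (by omega) hG.card_verts
    (fun i => norm_nonneg _) ?_ (hG.norm_eigenvalue_le_apply hk hα₀ hα₁ hx) hB hl hP hP'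
    fun s hs h => hc.eq_univ hs h
  exact fun h => hx0 (funext fun i => norm_eq_zero.1 (congrFun h i))

/-- A positive vector that satisfies the eigenvalue equations gives a lower bound. -/
theorem IsUniform.le_alphaSpectralRadius (hG : G.IsUniform k) (hk : 2 ≤ k) {α l : ℝ} (hl0 : 0 ≤ l)
    {x : G.vertexSet → ℝ} (hx0 : x ≠ 0)
    (hx : ∀ i, α * (#{e : G.edgeSet | i ∈ verts e} : ℝ) * x i ^ (k - 1) +
      (1 - α) * ∑ e : G.edgeSet with i ∈ verts e, ∏ u ∈ (verts e).erase i, x u =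
        l * x i ^ (k - 1)) : l ≤ G.alphaSpectralRadius k α := by
  have : (G.alphaTensor k α).IsEigenvalue (l : ℂ) := by
    refine ⟨fun i => (x i : ℂ), fun h => hx0 (funext fun i => ?_), fun i => ?_⟩
    · exact Complex.ofReal_eq_zero.1 (congrFun h i)
    · rw [hG.mulVec_alphaTensor hk]
      have := congrArg (fun t : ℝ => (t : ℂ)) (hx i)
      push_cast at this
      exact this
  have h := this.norm_le_spectralRadius
  rwa [Complex.norm_real, Real.norm_eq_abs, abs_of_nonneg hl0] at h

end

/-! ### Invariance of the spectral radius under isomorphism -/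

section Isomorphism

variable {W : Type*} {H : Hypergraph W}

/-- Isomorphisms act on sets of vertices in the subtype, so the degree is expressed there. -/
theorem degree_eq_ncard (K : Hypergraph V) (v : K.vertexSet) : K.degree v =
    {e : Set K.vertexSet | Subtype.val '' e ∈ K.edgeSet ∧ v ∈ e}.ncard := by
  rw [degree, ← Set.ncard_image_of_injective _ (Set.image_injective.2 Subtype.val_injective)]
  congr 1
  ext e
  constructor
  · rintro ⟨he, hv⟩
    have : Subtype.val '' (Subtype.val ⁻¹' e : Set K.vertexSet) = e := by
      rw [Subtype.image_preimage_coe, Set.inter_eq_right]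
      exact K.subset_vertexSet_of_mem_edgeSet' he
    exact ⟨Subtype.val ⁻¹' e, ⟨this.symm ▸ he, hv⟩, this⟩
  · rintro ⟨e, ⟨he, hv⟩, rfl⟩
    exact ⟨he, ⟨v, hv, rfl⟩⟩

theorem degree_eq_of_equiv (φ : G.vertexSet ≃ H.vertexSet)
    (h : ∀ e : Set G.vertexSet,
      Subtype.val '' e ∈ G.edgeSet ↔ Subtype.val '' (φ '' e) ∈ H.edgeSet) (i : G.vertexSet) :
    H.degree (φ i) = G.degree i := by
  rw [degree_eq_ncard, degree_eq_ncard, ← Set.ncard_image_of_injective _ (Set.image_injective.2 φ.injective)]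
  congr 1
  ext e
  constructor
  · rintro ⟨he, hi⟩
    refine ⟨φ.symm '' e, ⟨?_, ⟨φ i, hi, by simp⟩⟩, ?_⟩
    · rw [h, Equiv.image_symm_image]
      exact he
    · rw [← Set.image_comp, Equiv.self_comp_symm, Set.image_id]
  · rintro ⟨e, ⟨he, hi⟩, rfl⟩
    exact ⟨(h e).1 he, ⟨i, hi, rfl⟩⟩

theorem alphaTensor_apply_equiv (φ : G.vertexSet ≃ H.vertexSet)
    (h : ∀ e : Set G.vertexSet,
      Subtype.val '' e ∈ G.edgeSet ↔ Subtype.val '' (φ '' e) ∈ H.edgeSet) (α : ℝ)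
    (i : G.vertexSet) (j : Fin (k - 1) → G.vertexSet) :
    H.alphaTensor k α (φ i) (φ ∘ j) = G.alphaTensor k α i j := by
  have h1 : (insert (i : V) (Set.range fun t => (j t : V)) ∈ G.edgeSet) ↔
      insert (φ i : W) (Set.range fun t => ((φ ∘ j) t : W)) ∈ H.edgeSet := by
    have := h (insert i (Set.range j))
    simp only [Set.image_insert_eq, ← Set.range_comp] at this
    exact this
  simp only [alphaTensor, degreeTensor, adjacencyTensor, degree_eq_of_equiv φ h, h1,
    Function.comp_apply, EmbeddingLike.apply_eq_iff_eq]

variable [Fintype G.vertexSet] [Fintype H.vertexSet]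

theorem IsIsomorphic.alphaSpectralRadius_eq (h : G.IsIsomorphic H) (k : ℕ) (α : ℝ) :
    G.alphaSpectralRadius k α = H.alphaSpectralRadius k α := by
  obtain ⟨φ, h⟩ := h
  have hvec : ∀ (x : H.vertexSet → ℂ) (i : G.vertexSet), (G.alphaTensor k α).mulVec (x ∘ φ) i =
      (H.alphaTensor k α).mulVec x (φ i) := by
    intro x i
    unfold Tensor.mulVec
    refine Fintype.sum_equiv (Equiv.arrowCongr (Equiv.refl _) φ) _ _ fun j => ?_
    change _ = H.alphaTensor k α (φ i) (φ ∘ j) * ∏ t, x ((φ ∘ j) t)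
    rw [alphaTensor_apply_equiv φ h]
    rfl
  unfold alphaSpectralRadius Tensor.spectralRadius
  congr 1
  ext ρ
  refine exists_congr fun μ => and_congr_left fun _ => ?_
  constructor
  · rintro ⟨x, hx0, hx⟩
    refine ⟨x ∘ φ.symm, fun h0 => hx0 ?_, fun i => ?_⟩
    · funext i
      simpa using congrFun h0 (φ i)
    · have := hvec (x ∘ φ.symm) (φ.symm i)
      rw [Equiv.apply_symm_apply] at this
      rw [← this, Function.comp_assoc, Equiv.symm_comp_self, Function.comp_id, hx]
      rfl
  · rintro ⟨x, hx0, hx⟩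
    refine ⟨x ∘ φ, fun h0 => hx0 ?_, fun i => ?_⟩
    · funext i
      simpa using congrFun h0 (φ.symm i)
    · rw [hvec, hx]
      rfl

end Isomorphism

end Hypergraph

namespace Hypergraph

open Classical

variable {V : Type*} {G : Hypergraph V} {k : ℕ}

theorem IsUniform.nonempty (hG : G.IsUniform k) (hk : 2 ≤ k) : ∀ e ∈ G.edgeSet, e.Nonempty := by
  intro e he
  rw [Set.nonempty_iff_ne_empty]
  rintro rfl
  have := hG _ he
  simp at this
  omega

/-! ### Edges that are linked outside a vertex -/

/-- Two edges are adjacent if they share a vertex other than `v`. -/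
def linkGraph (G : Hypergraph V) (v : V) : SimpleGraph G.edgeSet where
  Adj e f := e ≠ f ∧ ∃ x, x ≠ v ∧ x ∈ (e : Set V) ∧ x ∈ (f : Set V)
  symm := ⟨fun _ _ h => ⟨h.1.symm, by obtain ⟨x, h1, h2, h3⟩ := h.2; exact ⟨x, h1, h3, h2⟩⟩⟩
  loopless := ⟨fun _ h => h.1 rfl⟩

theorem linkGraph_reachable_of_mem {v x : V} {e f : G.edgeSet} (hx : x ≠ v)
    (he : x ∈ (e : Set V)) (hf : x ∈ (f : Set V)) : (G.linkGraph v).Reachable e f := by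
  by_cases h : e = f
  · rw [h]
  · exact SimpleGraph.Adj.reachable ⟨h, x, hx, he, hf⟩

theorem IsConnected.forall_edge [Fintype G.vertexSet] (hG : G.IsConnected)
    (hne : ∀ e ∈ G.edgeSet, e.Nonempty) {P : G.edgeSet → Prop} {e : G.edgeSet} (he : P e)
    (h : ∀ f f' : G.edgeSet, ∀ y, y ∈ (f : Set V) → y ∈ (f' : Set V) → P f → P f')
    (f : G.edgeSet) : P f := by
  have hvert : ∀ f : G.edgeSet, ∃ u : G.vertexSet, u ∈ verts f := fun f => by
    obtain ⟨u, hu⟩ := hne f f.2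
    exact ⟨⟨u, G.subset_vertexSet_of_mem_edgeSet' f.2 hu⟩, mem_verts.2 hu⟩
  have huniv : {u : G.vertexSet | ∃ f : G.edgeSet, u ∈ verts f ∧ P f} = Set.univ := by
    refine hG.eq_univ ?_ ?_
    · obtain ⟨u, hu⟩ := hvert e
      exact ⟨u, e, hu, he⟩
    · rintro e' u hu ⟨f, huf, hf⟩ w hw
      exact ⟨e', hw, h f e' u (mem_verts.1 huf) (mem_verts.1 hu) hf⟩
  obtain ⟨u, hu⟩ := hvert f
  obtain ⟨f', hf', hP⟩ : u ∈ {u : G.vertexSet | ∃ f : G.edgeSet, u ∈ verts f ∧ P f} :=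
    huniv ▸ Set.mem_univ u
  exact h f' f u (mem_verts.1 hf') (mem_verts.1 hu) hP

/-- Follow intersecting edges from `e` to `f`, where `x` is the last point of contact with `e`. The
later links avoid `e`, so removing any vertex of `e` other than `x` leaves the connection intact. -/
theorem IsConnected.exists_forall_reachable [Fintype G.vertexSet] (hG : G.IsConnected)
    (hne : ∀ e ∈ G.edgeSet, e.Nonempty) (e f : G.edgeSet) :
    ∃ x, ∀ v ∈ (e : Set V), v ≠ x → (G.linkGraph v).Reachable f e := by
  refine hG.forall_edge hne
    (P := fun f => ∃ x, ∀ v ∈ (e : Set V), v ≠ x → (G.linkGraph v).Reachable f e) (e := e) ?_ ?_ f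
  · obtain ⟨x, hx⟩ := hne e e.2
    exact ⟨x, fun _ _ _ => SimpleGraph.Reachable.refl _⟩
  · rintro f f' y hf hf' ⟨x, hx⟩
    by_cases hy : y ∈ (e : Set V)
    · exact ⟨y, fun v _ hvy => linkGraph_reachable_of_mem hvy.symm hf' hy⟩
    · refine ⟨x, fun v hv hvx => (linkGraph_reachable_of_mem ?_ hf' hf).trans (hx v hv hvx)⟩
      rintro rfl
      exact hy hv

/-- Close up a shortest path of the link graph at `v`; minimality makes its linking vertices
distinct. -/
theorem exists_isCycle_of_reachable {v : V} {e e' : G.edgeSet} (hne : e ≠ e')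
    (hv : v ∈ (e : Set V)) (hv' : v ∈ (e' : Set V)) (h : (G.linkGraph v).Reachable e e') :
    ∃ C : G.Walk, C.IsCycle ∧ (v, (e : Set V)) ∈ C.incidences ∧
      (v, (e' : Set V)) ∈ C.incidences := by
  obtain ⟨p, hp, hlen⟩ := h.exists_path_of_dist
  set s := p.length with hs
  have hs0 : 0 < s := by
    rw [hlen]
    exact h.pos_dist_of_ne hne
  have hinj : ∀ i j, i ≤ s → j ≤ s → p.getVert i = p.getVert j → i = j :=
    fun i j hi hj hij => hp.getVert_injOn hi hj hij
  -- The existence claim covers all `i`, so that `choose` yields a total function; the value `v` for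
  -- `i ≥ s` plays no role.
  have hlink : ∀ i, ∃ x, i < s → x ≠ v ∧ x ∈ (p.getVert i : Set V) ∧
      x ∈ (p.getVert (i + 1) : Set V) := by
    intro i
    by_cases hi : i < s
    · obtain ⟨-, x, hx⟩ := p.adj_getVert_succ hi
      exact ⟨x, fun _ => hx⟩
    · exact ⟨v, fun h => absurd h hi⟩
  choose x hx using hlink
  -- A repeated linking vertex would join edge `i` directly to edge `j + 1`, a shortcut in a path of
  -- minimal length.
  have hxinj : ∀ i j, i < j → j < s → x i ≠ x j := by
    intro i j hij hj hxij
    have hadj : (G.linkGraph v).Adj (p.getVert i) (p.getVert (j + 1)) := by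
      refine ⟨fun h => ?_, x i, (hx i (by omega)).1, (hx i (by omega)).2.1, hxij ▸ (hx j hj).2.2⟩
      have := hinj _ _ (by omega) (by omega) h
      omega
    have := SimpleGraph.dist_le (((p.take i).append (SimpleGraph.Walk.cons hadj .nil)).append
      (p.drop (j + 1)))
    simp only [SimpleGraph.Walk.length_append, SimpleGraph.Walk.take_length,
      SimpleGraph.Walk.drop_length, SimpleGraph.Walk.length_cons,
      SimpleGraph.Walk.length_nil] at this
    omega
  -- The vertices of the cycle: `v, x 0, …, x (s - 1), v`.
  let f : ℕ → V := fun i => if i = 0 ∨ i = s + 1 then v else x (i - 1)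
  have hf0 : f 0 = v := if_pos (Or.inl rfl)
  have hfs : f (s + 1) = v := if_pos (Or.inr rfl)
  have hf : ∀ i, i < s → f (i + 1) = x i := fun i hi => if_neg (by omega)
  have hfne : ∀ i j, i < j → j ≤ s → f i ≠ f j := by
    intro i j hij hj
    obtain ⟨j, rfl⟩ : ∃ j', j = j' + 1 := ⟨j - 1, by omega⟩
    rw [hf j (by omega)]
    rcases Nat.eq_zero_or_pos i with rfl | hi
    · rw [hf0]
      exact (hx j (by omega)).1.symm
    · obtain ⟨i, rfl⟩ : ∃ i', i = i' + 1 := ⟨i - 1, by omega⟩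
      rw [hf i (by omega)]
      exact hxinj i j (by omega) (by omega)
  have hleft : ∀ i, i < s + 1 → f i ∈ (p.getVert i : Set V) := by
    intro i hi
    rcases Nat.eq_zero_or_pos i with rfl | hi0
    · rw [hf0, SimpleGraph.Walk.getVert_zero]
      exact hv
    · obtain ⟨i, rfl⟩ : ∃ i', i = i' + 1 := ⟨i - 1, by omega⟩
      rw [hf i (by omega)]
      exact (hx i (by omega)).2.2
  have hright : ∀ i, i < s + 1 → f (i + 1) ∈ (p.getVert i : Set V) := by
    intro i hi
    rcases Nat.lt_succ_iff_lt_or_eq.1 hi with hi | rfl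
    · rw [hf i hi]
      exact (hx i hi).2.1
    · rw [hfs, hs, SimpleGraph.Walk.getVert_length]
      exact hv'
  let C : G.Walk :=
    { length := s + 1
      vert := fun i => f i
      edge := fun i => p.getVert i
      vert_mem := fun i => by
        rcases Nat.lt_succ_iff_lt_or_eq.1 i.2 with hi | hi
        · exact G.subset_vertexSet_of_mem_edgeSet' (p.getVert i).2 (hleft i hi)
        · rw [hi, hfs]
          exact G.subset_vertexSet_of_mem_edgeSet' e.2 hv
      edge_mem := fun i => (p.getVert i).2
      left_mem := fun i => hleft i i.2
      right_mem := fun i => hright i i.2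
      vert_ne := fun i => by
        have hi := i.2
        change f i ≠ f (i + 1)
        rcases Nat.lt_succ_iff_lt_or_eq.1 hi with hi | hi
        · exact hfne _ _ (Nat.lt_succ_self _) hi
        · rw [hi, hfs, ← hf0]
          exact (hfne 0 s hs0 le_rfl).symm }
  refine ⟨C, ⟨by change 2 ≤ s + 1; omega, fun i j hij => ?_, ?_, fun i j hij => ?_⟩, ?_, ?_⟩
  · exact Fin.ext (hinj i j (Nat.lt_succ_iff.1 i.2) (Nat.lt_succ_iff.1 j.2) (Subtype.ext hij))
  · change f 0 = f (s + 1)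
    rw [hf0, hfs]
  · have hi := i.2
    have hj := j.2
    change f i = f j at hij
    change (i : ℕ) < s + 1 at hi
    change (j : ℕ) < s + 1 at hj
    rcases lt_trichotomy (i : ℕ) j with h | h | h
    · exact absurd hij (hfne _ _ h (by omega))
    · exact Fin.ext h
    · exact absurd hij.symm (hfne _ _ h (by omega))
  · refine Or.inl ⟨⟨0, Nat.succ_pos s⟩, ?_⟩
    change (f 0, (p.getVert 0 : Set V)) = _
    rw [hf0, SimpleGraph.Walk.getVert_zero]
  · refine Or.inr ⟨⟨s, Nat.lt_succ_self s⟩, ?_⟩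
    change (f (s + 1), (p.getVert s : Set V)) = _
    rw [hfs, hs, SimpleGraph.Walk.getVert_length]

/-! ### Cycles -/

namespace Walk

theorem IsCycle.vert_succ_injective {C : G.Walk} (hC : C.IsCycle) :
    Function.Injective fun i : Fin C.length => C.vert i.succ := by
  obtain ⟨h2, -, hclosed, hinj⟩ := hC
  have key : ∀ i : Fin C.length, ∃ j : Fin C.length, C.vert i.succ = C.vert j.castSucc ∧
      (j : ℕ) = if (i : ℕ) + 1 = C.length then (0 : ℕ) else (i : ℕ) + 1 := by
    intro i
    by_cases h : (i : ℕ) + 1 = C.length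
    · refine ⟨⟨0, by omega⟩, ?_, by rw [if_pos h]⟩
      have : i.succ = Fin.last C.length := Fin.ext h
      rw [this, ← hclosed]
      rfl
    · exact ⟨⟨i + 1, by omega⟩, rfl, by rw [if_neg h]⟩
  intro a b hab
  obtain ⟨a', ha, ha'⟩ := key a
  obtain ⟨b', hb, hb'⟩ := key b
  have : a' = b' := hinj (ha.symm.trans (hab.trans hb))
  rw [this, hb'] at ha'
  have := a.2
  have := b.2
  apply Fin.ext
  split_ifs at ha' <;> omega

theorem mem_incidences_edge_iff {C : G.Walk} (hC : C.IsCycle) (i : Fin C.length) (v : V) :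
    (v, C.edge i) ∈ C.incidences ↔ v = C.vert i.castSucc ∨ v = C.vert i.succ := by
  constructor
  · rintro (⟨j, hj⟩ | ⟨j, hj⟩)
    · rw [Prod.mk.injEq] at hj
      rw [← hC.2.1 hj.2]
      exact Or.inl hj.1.symm
    · rw [Prod.mk.injEq] at hj
      rw [← hC.2.1 hj.2]
      exact Or.inr hj.1.symm
  · rintro (rfl | rfl)
    · exact Or.inl ⟨i, rfl⟩
    · exact Or.inr ⟨i, rfl⟩

theorem exists_of_mem_incidences {C : G.Walk} {v : V} {e : Set V} (h : (v, e) ∈ C.incidences) :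
    v ∈ e ∧ ∃ i, C.edge i = e := by
  rcases h with ⟨j, hj⟩ | ⟨j, hj⟩ <;> rw [Prod.mk.injEq] at hj <;> obtain ⟨rfl, rfl⟩ := hj
  · exact ⟨C.left_mem j, j, rfl⟩
  · exact ⟨C.right_mem j, j, rfl⟩

theorem exists_edge_eq_iff {C : G.Walk} {e : Set V} :
    (∃ i, C.edge i = e) ↔ ∃ v, (v, e) ∈ C.incidences :=
  ⟨by rintro ⟨i, rfl⟩; exact ⟨_, Or.inl ⟨i, rfl⟩⟩,
    fun ⟨_, h⟩ => (exists_of_mem_incidences h).2⟩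

/-- A vertex is the start of at most one step of a cycle and the end of at most one. -/
theorem IsCycle.ncard_edges_le_two {C : G.Walk} (hC : C.IsCycle) (v : V) :
    {e | (v, e) ∈ C.incidences}.ncard ≤ 2 := by
  have h : {e | (v, e) ∈ C.incidences} ⊆ C.edge '' {i | C.vert i.castSucc = v} ∪
      C.edge '' {i | C.vert i.succ = v} := by
    rintro e (⟨j, hj⟩ | ⟨j, hj⟩) <;> rw [Prod.mk.injEq] at hj
    · exact Or.inl ⟨j, hj.1, hj.2⟩
    · exact Or.inr ⟨j, hj.1, hj.2⟩
  refine (Set.ncard_le_ncard h (Set.toFinite _)).trans ((Set.ncard_union_le _ _).trans ?_)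
  have h1 : (C.edge '' {i | C.vert i.castSucc = v}).ncard ≤ 1 :=
    (Set.ncard_image_le (Set.toFinite _)).trans <| (Set.ncard_le_one_iff (Set.toFinite _)).2
      fun ha hb => hC.2.2.2 ((show C.vert _ = v from ha).trans (show C.vert _ = v from hb).symm)
  have h2 : (C.edge '' {i | C.vert i.succ = v}).ncard ≤ 1 :=
    (Set.ncard_image_le (Set.toFinite _)).trans <| (Set.ncard_le_one_iff (Set.toFinite _)).2
      fun ha hb => hC.vert_succ_injective
        ((show C.vert _ = v from ha).trans (show C.vert _ = v from hb).symm)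
  omega

/-- A cycle passes through `v` at most once as a linking vertex, so one of the two arcs between the
given edges avoids it. -/
theorem IsCycle.reachable {C : G.Walk} (hC : C.IsCycle) (v : V) (i j : Fin C.length) :
    (G.linkGraph v).Reachable ⟨C.edge i, C.edge_mem i⟩ ⟨C.edge j, C.edge_mem j⟩ := by
  have seg : ∀ d p : ℕ, ∀ h : p + d < C.length,
      (∀ q, ∀ hq : q < C.length, p < q → q ≤ p + d → C.vert (Fin.castSucc ⟨q, hq⟩) ≠ v) →
      (G.linkGraph v).Reachable ⟨C.edge ⟨p, by omega⟩, C.edge_mem _⟩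
        ⟨C.edge ⟨p + d, h⟩, C.edge_mem _⟩ := by
    intro d
    induction d with
    | zero => exact fun p h _ => SimpleGraph.Reachable.refl _
    | succ d ih =>
      intro p h hq
      refine (ih p (by omega) fun q hq' h1 h2 => hq q hq' h1 (by omega)).trans ?_
      exact linkGraph_reachable_of_mem (hq (p + d + 1) h (by omega) (by omega))
        (C.right_mem ⟨p + d, by omega⟩) (C.left_mem ⟨p + d + 1, h⟩)
  wlog hij : i ≤ j generalizing i j
  · exact (this j i (le_of_not_ge hij)).symm
  have hij' : (i : ℕ) ≤ j := hij
  have hj := j.2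
  -- If `v` links two edges on the arc from `i` to `j`, go on from `j` to the last edge, across the
  -- closing vertex to edge `0`, and up to `i`.
  by_cases hv : ∃ q, ∃ hq : q < C.length, (i : ℕ) < q ∧ q ≤ j ∧ C.vert (Fin.castSucc ⟨q, hq⟩) = v
  · obtain ⟨q, hq, h1, h2, h3⟩ := hv
    have hne : ∀ q', ∀ hq' : q' < C.length, q' ≠ q → C.vert (Fin.castSucc ⟨q', hq'⟩) ≠ v := by
      intro q' hq' hqq h
      exact hqq (congrArg Fin.val (hC.2.2.2 (h.trans h3.symm)))
    have s1 := seg (C.length - 1 - j) j (by omega) fun q' hq' _ _ => hne q' hq' (by omega)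
    have s2 := seg i 0 (by omega) fun q' hq' _ _ => hne q' hq' (by omega)
    have s3 : (G.linkGraph v).Reachable
        ⟨C.edge ⟨j + (C.length - 1 - j), by omega⟩, C.edge_mem _⟩
        ⟨C.edge ⟨0, by omega⟩, C.edge_mem _⟩ := by
      refine linkGraph_reachable_of_mem (hne 0 (by omega) (by omega)) ?_ (C.left_mem _)
      have := C.right_mem ⟨j + (C.length - 1 - j), by omega⟩
      have hlast : (Fin.succ ⟨j + (C.length - 1 - j), by omega⟩ : Fin (C.length + 1)) =
          Fin.last C.length := Fin.ext (by simp; omega)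
      rw [hlast, ← hC.2.2.1] at this
      exact this
    have s4 := (s1.trans s3).trans s2
    simp only [Nat.zero_add] at s4
    exact s4.symm
  · push Not at hv
    have s1 := seg (j - i) i (by omega) fun q hq h1 h2 => hv q hq h1 (by omega)
    have e1 : (⟨i + (j - i), by omega⟩ : Fin C.length) = j := Fin.ext (by simp; omega)
    simp only [e1] at s1
    exact s1

end Walk

/-- A common edge already provides `k ≥ 2` common vertices. Hence the cycles of a hypercactus are
edge-disjoint. -/
theorem IsHypercactus.incidences_eq (hG : G.IsHypercactus k) (hk : 2 ≤ k) {C C' : G.Walk}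
    (hC : C.IsCycle) (hC' : C'.IsCycle) {i : Fin C.length} {j : Fin C'.length}
    (h : C.edge i = C'.edge j) : C.incidences = C'.incidences := by
  by_contra hne
  have h1 := hG.uniform _ (C.edge_mem i)
  have hfin : (C.edge i).Finite := Set.finite_of_ncard_pos (by omega)
  obtain ⟨a, b, ha, hb, hab⟩ := (Set.one_lt_ncard_iff hfin).1 (by omega)
  have hsub : ∀ x ∈ C.edge i, x ∈ C.toHypergraph.vertexSet ∩ C'.toHypergraph.vertexSet :=
    fun x hx => ⟨Set.mem_iUnion.2 ⟨i, hx⟩, Set.mem_iUnion.2 ⟨j, h ▸ hx⟩⟩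
  exact hab (hG.inter_subsingleton C C' hC hC' hne (hsub a ha) (hsub b hb))

theorem finite_cycles [Fintype G.vertexSet] : G.cycles.Finite := by
  refine ((Set.toFinite G.vertexSet).prod G.finite_edgeSet).powerset.subset ?_
  rintro _ ⟨W, -, rfl⟩ ⟨v, e⟩ h
  obtain ⟨hv, i, rfl⟩ := Walk.exists_of_mem_incidences h
  exact ⟨G.subset_vertexSet_of_mem_edgeSet' (W.edge_mem i) hv, W.edge_mem i⟩

end Hypergraph

/-! ### Two inequalities for real numbers -/

theorem one_sub_sum_le_prod {ι : Type*} (s : Finset ι) {y : ι → ℝ} (h0 : ∀ i ∈ s, 0 ≤ y i)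
    (h1 : ∀ i ∈ s, y i ≤ 1) : 1 - ∑ i ∈ s, y i ≤ ∏ i ∈ s, (1 - y i) := by
  classical
  induction s using Finset.induction_on with
  | empty => simp
  | insert i s hi ih =>
    rw [sum_insert hi, prod_insert hi]
    have h := ih (fun j hj => h0 j (mem_insert_of_mem hj)) fun j hj => h1 j (mem_insert_of_mem hj)
    have hs : 0 ≤ ∑ i ∈ s, y i := sum_nonneg fun j hj => h0 j (mem_insert_of_mem hj)
    have hy := h0 i (mem_insert_self i s)
    have hy1 := sub_nonneg.2 (h1 i (mem_insert_self i s))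
    nlinarith [mul_le_mul_of_nonneg_left h hy1, mul_nonneg hy hs]

/-- Two positive terms leave the positive cross term `y u * y v`, scaled by a remainder that stays
positive because the sum is below 1. -/
theorem one_sub_sum_lt_prod {ι : Type*} (s : Finset ι) {y : ι → ℝ} (h0 : ∀ i ∈ s, 0 ≤ y i)
    (h1 : ∑ i ∈ s, y i < 1) {u v : ι} (hu : u ∈ s) (hv : v ∈ s) (huv : u ≠ v) (hyu : 0 < y u)
    (hyv : 0 < y v) : 1 - ∑ i ∈ s, y i < ∏ i ∈ s, (1 - y i) := by
  classical
  have hle : ∀ i ∈ s, y i ≤ 1 := fun i hi => (single_le_sum h0 hi).trans h1.le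
  have hv' : v ∈ s.erase u := mem_erase.2 ⟨huv.symm, hv⟩
  rw [← add_sum_erase s y hu, ← mul_prod_erase s _ hu, ← add_sum_erase _ y hv',
    ← mul_prod_erase _ _ hv'] at *
  have hrest := one_sub_sum_le_prod ((s.erase u).erase v)
    (fun i hi => h0 i (mem_of_mem_erase (mem_of_mem_erase hi)))
    (fun i hi => hle i (mem_of_mem_erase (mem_of_mem_erase hi)))
  have hs : 0 ≤ ∑ i ∈ (s.erase u).erase v, y i :=
    sum_nonneg fun j hj => h0 j (mem_of_mem_erase (mem_of_mem_erase hj))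
  set S := ∑ i ∈ (s.erase u).erase v, y i
  set P := ∏ i ∈ (s.erase u).erase v, (1 - y i)
  have hy1 : 0 ≤ (1 - y u) * (1 - y v) :=
    mul_nonneg (sub_nonneg.2 (hle u hu)) (sub_nonneg.2 (hle v hv))
  have := mul_le_mul_of_nonneg_left hrest hy1
  nlinarith [mul_pos (mul_pos hyu hyv) (show 0 < 1 - S by linarith),
    mul_nonneg hs (add_pos hyu hyv).le]

section Excess

variable {ι : Type*} {s : Finset ι} {g t m : ι → ℝ} {D η : ℝ}

/-- Since `t v ≤ 1 / D`, the losses `t v * m v` add up to at most `1 - η / D`, and `∏ g * (η / D) =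
1` absorbs exactly this. Equality leaves room for only one positive loss. -/
theorem one_le_prod_of_excess (hD : 0 < D) (hη : 0 < η) (hg : ∀ v ∈ s, 0 < g v)
    (ht : ∀ v ∈ s, 0 < t v ∧ t v ≤ 1 / D) (hm : ∀ v ∈ s, 0 ≤ m v) (hsum : ∑ v ∈ s, m v ≤ D - η)
    (hprod : (∏ v ∈ s, g v) * (η / D) = 1) :
    (∀ v ∈ s, 0 < g v * (1 - t v * m v)) ∧ 1 ≤ ∏ v ∈ s, g v * (1 - t v * m v) ∧
      (∏ v ∈ s, g v * (1 - t v * m v) ≤ 1 →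
        ∑ v ∈ s, m v = D - η ∧ ∀ u ∈ s, ∀ v ∈ s, 0 < m u → 0 < m v → u = v) := by
  have hG : 0 < ∏ v ∈ s, g v := prod_pos hg
  have hy0 : ∀ v ∈ s, 0 ≤ t v * m v := fun v hv => mul_nonneg (ht v hv).1.le (hm v hv)
  have hle : ∑ v ∈ s, t v * m v ≤ (∑ v ∈ s, m v) / D := by
    rw [sum_div]
    refine sum_le_sum fun v hv => ?_
    rw [div_eq_mul_one_div, mul_comm]
    exact mul_le_mul_of_nonneg_left (ht v hv).2 (hm v hv)
  have hlt : (∑ v ∈ s, m v) / D ≤ 1 - η / D := by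
    rw [div_le_iff₀ hD, sub_mul, div_mul_cancel₀ _ hD.ne', one_mul]
    exact hsum
  have hηD : 0 < η / D := div_pos hη hD
  have hone : ∑ v ∈ s, t v * m v < 1 := by linarith
  have hle1 : ∀ v ∈ s, t v * m v < 1 := fun v hv => (single_le_sum hy0 hv).trans_lt hone
  have hprod' : ∏ v ∈ s, g v * (1 - t v * m v) = (∏ v ∈ s, g v) * ∏ v ∈ s, (1 - t v * m v) :=
    prod_mul_distrib
  have hmain := one_sub_sum_le_prod s hy0 fun v hv => (hle1 v hv).le
  refine ⟨fun v hv => mul_pos (hg v hv) (sub_pos.2 (hle1 v hv)), ?_, fun h => ⟨?_, ?_⟩⟩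
  · rw [hprod']
    exact hprod.symm.le.trans (mul_le_mul_of_nonneg_left (by linarith) hG.le)
  · rw [hprod'] at h
    have h' := le_of_mul_le_mul_left (h.trans hprod.symm.le) hG
    have : 1 - η / D ≤ (∑ v ∈ s, m v) / D := by linarith
    rw [le_div_iff₀ hD, sub_mul, div_mul_cancel₀ _ hD.ne', one_mul] at this
    exact le_antisymm hsum this
  · intro u hu v hv hmu hmv
    by_contra huv
    have h2 := one_sub_sum_lt_prod s hy0 hone hu hv huv (mul_pos (ht u hu).1 hmu)
      (mul_pos (ht v hv).1 hmv)
    rw [hprod'] at h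
    have h' := le_of_mul_le_mul_left (h.trans hprod.symm.le) hG
    linarith

end Excess

namespace Hypergraph

open Classical

variable {V : Type*} {G : Hypergraph V} {k : ℕ} [Fintype G.vertexSet]

/-! ### Branches at a vertex and their weights -/

/-- The edges that are linked to `e` outside `v`. -/
noncomputable def branch (v : V) (e : G.edgeSet) : Finset G.edgeSet :=
  {f | (G.linkGraph v).Reachable f e}

/-- The number of edges at `v` that are linked to `e` outside `v`. -/
noncomputable def branchDegree (v : V) (e : G.edgeSet) : ℕ :=
  #((branch v e).filter fun f : G.edgeSet => v ∈ (f : Set V))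

theorem mem_branch {v : V} {e f : G.edgeSet} :
    f ∈ branch v e ↔ (G.linkGraph v).Reachable f e := by
  simp [branch]

theorem branch_eq_of_mem {v : V} {e f : G.edgeSet} (h : f ∈ branch v e) :
    branch v f = branch v e := by
  ext e'
  rw [mem_branch, mem_branch]
  rw [mem_branch] at h
  exact ⟨fun h' => h'.trans h, fun h' => h'.trans h.symm⟩

theorem self_mem_branch (v : V) (e : G.edgeSet) : e ∈ branch v e :=
  mem_branch.2 (SimpleGraph.Reachable.refl e)

theorem branchDegree_pos {v : V} {e : G.edgeSet} (hv : v ∈ (e : Set V)) : 0 < branchDegree v e :=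
  card_pos.2 ⟨e, mem_filter.2 ⟨self_mem_branch v e, hv⟩⟩

/-- Each branch occurs once for each of its edges at `v` and is divided by their number, so every
`f` contributes its weight at most once. -/
theorem sum_branch_div_le (w : G.edgeSet → ℝ) (hw : ∀ f, 0 ≤ w f) (v : G.vertexSet) :
    ∑ e : G.edgeSet with v ∈ verts e, (∑ f ∈ branch (v : V) e, w f) / branchDegree (v : V) e ≤
      ∑ f, w f := by
  have h1 : ∀ e : G.edgeSet, (∑ f ∈ branch (v : V) e, w f) / branchDegree (v : V) e =
      ∑ f, if f ∈ branch (v : V) e then w f * (1 / branchDegree (v : V) e : ℝ) else 0 := by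
    intro e
    rw [← sum_filter, ← sum_mul, div_eq_mul_one_div]
    congr 2
    ext f
    simp
  rw [sum_congr rfl fun e _ => h1 e, sum_comm]
  refine sum_le_sum fun f _ => ?_
  have h2 : ∀ e : G.edgeSet,
      (if f ∈ branch (v : V) e then w f * (1 / branchDegree (v : V) e : ℝ) else 0) =
      if e ∈ branch (v : V) f then w f * (1 / branchDegree (v : V) f : ℝ) else 0 := by
    intro e
    by_cases h : f ∈ branch (v : V) e
    · rw [if_pos h, if_pos (mem_branch.2 (mem_branch.1 h).symm), branchDegree, branchDegree,
        branch_eq_of_mem h]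
    · rw [if_neg h, if_neg fun h' => h (mem_branch.2 (mem_branch.1 h').symm)]
  rw [sum_congr rfl fun e _ => h2 e, ← sum_filter, sum_const, nsmul_eq_mul]
  have h3 : #(({e | v ∈ verts e} : Finset G.edgeSet).filter fun e => e ∈ branch (v : V) f) =
      branchDegree (v : V) f := by
    rw [branchDegree]
    congr 1
    ext e
    simp [and_comm]
  rw [h3]
  -- A component with no edge at `v` contributes nothing, which is why only an inequality holds.
  rcases Nat.eq_zero_or_pos (branchDegree (v : V) f) with h | h
  · rw [h]
    simpa using hw f
  · have : (0 : ℝ) < branchDegree (v : V) f := by exact_mod_cast h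
    field_simp
    exact le_rfl

/-- No edge is cut off from `e` at two vertices of `e`, by `IsConnected.exists_forall_reachable`, so
the complements of the branches are disjoint. As weights are positive, equality means that every
edge outside `s` is cut off somewhere. -/
theorem sum_verts_sum_compl_branch_le (hc : G.IsConnected) (hne : ∀ e ∈ G.edgeSet, e.Nonempty)
    {w : G.edgeSet → ℝ} (hw : ∀ f, 0 < w f) {e : G.edgeSet} {s : Finset G.edgeSet}
    (hs : ∀ f ∈ s, ∀ v ∈ verts e, f ∈ branch (v : V) e) :
    ∑ v ∈ verts e, ∑ f ∈ (branch (v : V) e)ᶜ, w f ≤ ∑ f ∈ sᶜ, w f ∧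
      (∑ v ∈ verts e, ∑ f ∈ (branch (v : V) e)ᶜ, w f = ∑ f ∈ sᶜ, w f →
        ∀ f ∉ s, ∃ v ∈ verts e, f ∉ branch (v : V) e) := by
  have h1 : ∑ v ∈ verts e, ∑ f ∈ (branch (v : V) e)ᶜ, w f =
      ∑ f ∈ sᶜ, (#((verts e).filter fun v : G.vertexSet => f ∉ branch (v : V) e) : ℝ) * w f := by
    have h2 : ∀ v ∈ verts e, ∑ f ∈ (branch (v : V) e)ᶜ, w f =
        ∑ f ∈ sᶜ, if f ∉ branch (v : V) e then w f else 0 := by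
      intro v hv
      rw [← sum_filter]
      refine sum_congr ?_ fun _ _ => rfl
      ext f
      simp only [mem_compl, mem_filter]
      exact ⟨fun h => ⟨fun hf => h (hs f hf v hv), h⟩, fun h => h.2⟩
    rw [sum_congr rfl h2, sum_comm]
    refine sum_congr rfl fun f _ => ?_
    rw [← sum_filter, sum_const, nsmul_eq_mul]
  have h3 : ∀ f, #((verts e).filter fun v : G.vertexSet => f ∉ branch (v : V) e) ≤ 1 := by
    intro f
    obtain ⟨x, hx⟩ := hc.exists_forall_reachable hne e f
    refine card_le_one.2 fun u hu v hv => ?_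
    have key : ∀ u ∈ ((verts e).filter fun v : G.vertexSet => f ∉ branch (v : V) e), (u : V) = x := by
      intro u hu
      by_contra hux
      exact (mem_filter.1 hu).2 (mem_branch.2 (hx u (mem_verts.1 (mem_filter.1 hu).1) hux))
    exact Subtype.ext ((key u hu).trans (key v hv).symm)
  have h4 : ∀ f ∈ sᶜ, (#((verts e).filter fun v : G.vertexSet => f ∉ branch (v : V) e) : ℝ) * w f ≤ w f := fun f _ =>
    mul_le_of_le_one_left (hw f).le (by exact_mod_cast h3 f)
  rw [h1]
  refine ⟨sum_le_sum h4, fun h f hf => ?_⟩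
  have h5 := (sum_eq_sum_iff_of_le h4).1 h f (mem_compl.2 hf)
  by_contra! hcon
  rw [filter_eq_empty_iff.2 fun v hv => not_not.2 (hcon v hv)] at h5
  simp only [card_empty, Nat.cast_zero, zero_mul] at h5
  exact (hw f).ne h5

/-- The product of the weights over an edge `e`, where `T` is the set of the vertices of `e` that
may lie in a further edge of the same branch. -/
theorem one_le_prod_branch (hc : G.IsConnected) (hne : ∀ e ∈ G.edgeSet, e.Nonempty)
    {w : G.edgeSet → ℝ} (hw : ∀ f, 0 < w f) {a b D η : ℝ} (ha : 0 ≤ a) (hab : a < b)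
    (hL : ∑ f, w f = a + b) (hD : 0 < D) (hη : 0 < η) {e : G.edgeSet} {s : Finset G.edgeSet}
    (hs : ∀ f ∈ s, ∀ v ∈ verts e, f ∈ branch (v : V) e) {T : Finset G.vertexSet}
    (hT : ∀ v ∈ verts e, branchDegree (v : V) e ≤ if v ∈ T then 2 else 1)
    (hDb : D ≤ b) (hDT : ∀ v ∈ verts e, v ∈ T → D ≤ b - a) (hsum : ∑ f ∈ sᶜ, w f ≤ D - η)
    (hprod : (∏ v ∈ verts e, if v ∈ T then (b - a) / 2 else b) * (η / D) = 1) :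
    (∀ v ∈ verts e, 0 < (∑ f ∈ branch (v : V) e, w f) / branchDegree (v : V) e - a) ∧
    1 ≤ ∏ v ∈ verts e, ((∑ f ∈ branch (v : V) e, w f) / branchDegree (v : V) e - a) ∧
    (∏ v ∈ verts e, ((∑ f ∈ branch (v : V) e, w f) / branchDegree (v : V) e - a) ≤ 1 →
      ∑ f ∈ sᶜ, w f = D - η ∧ (∀ f ∉ s, ∃ v ∈ verts e, f ∉ branch (v : V) e) ∧
      ∀ u ∈ verts e, ∀ v ∈ verts e, ∀ f ∉ branch (u : V) e, ∀ f' ∉ branch (v : V) e, u = v) := by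
  -- Factorisation with missing mass `M`: for branch degree 2, `(a + b - M) / 2 - a = (b - a) / 2 *
  -- (1 - M / (b - a))`; for branch degree 1, `a + b - M - a = b * (1 - M / b)`.
  set g : G.vertexSet → ℝ := fun v => if v ∈ T then (b - a) / 2 else b with hg
  set t : G.vertexSet → ℝ := fun v => if v ∈ T then 1 / (b - a) else 1 / b with ht
  set M : G.vertexSet → ℝ := fun v => ∑ f ∈ (branch (v : V) e)ᶜ, w f with hM
  have hb : 0 < b := ha.trans_lt hab
  have hba : 0 < b - a := sub_pos.2 hab
  obtain ⟨hle, heq⟩ := sum_verts_sum_compl_branch_le hc hne hw hs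
  have hM0 : ∀ v ∈ verts e, 0 ≤ M v := fun v _ => sum_nonneg fun f _ => (hw f).le
  obtain ⟨hpos, hone, htight⟩ := one_le_prod_of_excess (s := verts e) (g := g) (t := t) (m := M)
    hD hη (fun v _ => by simp only [hg]; split_ifs <;> positivity)
    (fun v hv => by
      simp only [ht]
      split_ifs with h
      · exact ⟨by positivity, one_div_le_one_div_of_le hD (hDT v hv h)⟩
      · exact ⟨by positivity, one_div_le_one_div_of_le hD hDb⟩) hM0 (hle.trans hsum) hprod
  have hB : ∀ v ∈ verts e, g v * (1 - t v * M v) ≤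
      (∑ f ∈ branch (v : V) e, w f) / branchDegree (v : V) e - a := by
    intro v hv
    have h1 : ∑ f ∈ branch (v : V) e, w f = a + b - M v := by
      rw [← hL, ← sum_add_sum_compl (branch (v : V) e) w]
      simp only [hM]
      ring
    have h2 : (0 : ℝ) ≤ ∑ f ∈ branch (v : V) e, w f := sum_nonneg fun f _ => (hw f).le
    have h3 : (0 : ℝ) < branchDegree (v : V) e := by
      exact_mod_cast branchDegree_pos (mem_verts.1 hv)
    have h4 := hT v hv
    rw [h1] at h2 ⊢
    simp only [hg, ht]
    split_ifs at h4 ⊢ with h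
    · have h5 : (branchDegree (v : V) e : ℝ) ≤ 2 := by exact_mod_cast h4
      have h6 := div_le_div_of_nonneg_left h2 h3 h5
      have h7 : (b - a) / 2 * (1 - 1 / (b - a) * M v) = (a + b - M v) / 2 - a := by
        field_simp
        ring
      linarith
    · have h5 : (branchDegree (v : V) e : ℝ) ≤ 1 := by exact_mod_cast h4
      have h6 := div_le_div_of_nonneg_left h2 h3 h5
      have h7 : b * (1 - 1 / b * M v) = (a + b - M v) / 1 - a := by
        field_simp
        ring
      linarith
  have hpp := prod_le_prod (fun v hv => (hpos v hv).le) hB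
  refine ⟨fun v hv => (hpos v hv).trans_le (hB v hv), hone.trans hpp, fun h => ?_⟩
  obtain ⟨h1, h2⟩ := htight (hpp.trans h)
  have h3 : ∑ v ∈ verts e, M v = ∑ f ∈ sᶜ, w f := le_antisymm hle (by rw [h1]; exact hsum)
  refine ⟨by rw [← h3, h1], heq h3, fun u hu v hv f hf f' hf' => h2 u hu v hv ?_ ?_⟩
  · exact sum_pos (fun f _ => hw f) ⟨f, mem_compl.2 hf⟩
  · exact sum_pos (fun f _ => hw f) ⟨f', mem_compl.2 hf'⟩

/-! ### The weights of the edges of a hypercactus -/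

/-- The edges of a cycle that is given by its incidences. -/
noncomputable def cycleEdges (I : Set (V × Set V)) : Finset G.edgeSet :=
  {f | ∃ v, (v, (f : Set V)) ∈ I}

theorem mem_cycleEdges {C : G.Walk} {f : G.edgeSet} :
    f ∈ cycleEdges C.incidences ↔ ∃ i, C.edge i = f := by
  simp [cycleEdges, Walk.exists_edge_eq_iff]

theorem Walk.IsCycle.card_cycleEdges {C : G.Walk} (hC : C.IsCycle) :
    #(cycleEdges (G := G) C.incidences) = C.length := by
  have : cycleEdges (G := G) C.incidences = univ.image fun i => ⟨C.edge i, C.edge_mem i⟩ := by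
    ext f
    rw [mem_cycleEdges]
    simp [Subtype.ext_iff]
  rw [this, card_image_of_injective, card_univ, Fintype.card_fin]
  exact fun i j hij => hC.2.1 (congrArg Subtype.val hij)

/-- Every edge has weight `θ`, and every cycle distributes the weight `δ` among its edges. -/
noncomputable def edgeWeight (θ δ : ℝ) (f : G.edgeSet) : ℝ :=
  θ + δ * ∑ I ∈ G.finite_cycles.toFinset,
    if f ∈ cycleEdges I then 1 / (#(cycleEdges (G := G) I) : ℝ) else 0

theorem le_edgeWeight {θ δ : ℝ} (hδ : 0 ≤ δ) (f : G.edgeSet) : θ ≤ edgeWeight θ δ f := by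
  have : 0 ≤ ∑ I ∈ G.finite_cycles.toFinset,
      if f ∈ cycleEdges I then 1 / (#(cycleEdges (G := G) I) : ℝ) else 0 :=
    sum_nonneg fun I _ => by split_ifs <;> positivity
  have := mul_nonneg hδ this
  unfold edgeWeight
  linarith

theorem sum_edgeWeight (θ δ : ℝ) :
    ∑ f : G.edgeSet, edgeWeight θ δ f = G.edgeSet.ncard * θ + δ * G.cycles.ncard := by
  unfold edgeWeight
  rw [sum_add_distrib, sum_const, nsmul_eq_mul, card_univ, ← mul_sum, sum_comm,
    ← Nat.card_eq_fintype_card, Nat.card_coe_set_eq]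
  congr 2
  rw [Set.ncard_eq_toFinset_card _ G.finite_cycles, card_eq_sum_ones, Nat.cast_sum]
  refine sum_congr rfl fun I hI => ?_
  obtain ⟨C, hC, rfl⟩ := G.finite_cycles.mem_toFinset.1 hI
  have h2 := hC.1
  have h3 := hC.card_cycleEdges
  have : (0 : ℝ) < #(cycleEdges (G := G) C.incidences) := by
    rw [h3]
    exact_mod_cast (by omega : 0 < C.length)
  rw [← sum_filter, sum_const, nsmul_eq_mul, filter_mem_eq_inter, univ_inter]
  field_simp
  simp

/-- The cycle returns its own share `δ` in full; shares of other cycles could only add to it. -/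
theorem Walk.IsCycle.le_sum_edgeWeight {C : G.Walk} (hC : C.IsCycle) {θ δ : ℝ} (hδ : 0 ≤ δ) :
    C.length * θ + δ ≤ ∑ f ∈ cycleEdges (G := G) C.incidences, edgeWeight θ δ f := by
  unfold edgeWeight
  rw [sum_add_distrib, sum_const, nsmul_eq_mul, hC.card_cycleEdges, ← mul_sum]
  have h2 := hC.1
  have h3 := hC.card_cycleEdges
  have h4 : (0 : ℝ) < C.length := by exact_mod_cast (by omega : 0 < C.length)
  have : (1 : ℝ) ≤ ∑ f ∈ cycleEdges (G := G) C.incidences, ∑ I ∈ G.finite_cycles.toFinset,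
      if f ∈ cycleEdges I then 1 / (#(cycleEdges (G := G) I) : ℝ) else 0 := by
    calc (1 : ℝ) = ∑ f ∈ cycleEdges (G := G) C.incidences, 1 / (C.length : ℝ) := by
          rw [sum_const, nsmul_eq_mul, h3]
          field_simp
      _ ≤ _ := by
          refine sum_le_sum fun f hf => ?_
          refine le_trans (le_of_eq ?_) (single_le_sum (f := fun I =>
            if f ∈ cycleEdges I then 1 / (#(cycleEdges (G := G) I) : ℝ) else 0)
            (fun I _ => ?_) (G.finite_cycles.mem_toFinset.2 ⟨C, hC, rfl⟩))
          · simp only [if_pos hf, h3]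
          · split_ifs <;> positivity
  nlinarith

end Hypergraph

/-! ### Tight edges and the upper bound for hypercacti -/

namespace Hypergraph

open Classical

variable {V : Type*} {G : Hypergraph V} {k : ℕ} [Fintype G.vertexSet]

/-- Two edges lie on a common cycle. -/
def OnCommonCycle (e f : G.edgeSet) : Prop :=
  ∃ C : G.Walk, C.IsCycle ∧ (∃ i, C.edge i = e) ∧ ∃ i, C.edge i = f

/-- All the other blocks are attached to the edge at one and the same vertex, and every cycle
through the edge has length `2`. -/
structure IsTight (e : G.edgeSet) : Prop where
  eq_of_notMem_branch : ∀ u ∈ verts e, ∀ v ∈ verts e, ∀ f ∉ branch (u : V) e,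
    ∀ f' ∉ branch (v : V) e, u = v
  exists_notMem_branch : ∀ f, f ≠ e → ¬OnCommonCycle e f → ∃ v ∈ verts e, f ∉ branch (v : V) e
  length_eq_two : ∀ C : G.Walk, C.IsCycle → (∃ i, C.edge i = e) → C.length = 2

/-- A second edge at `v` in the branch of `e` would close a cycle passing through `v` and `e`. -/
theorem branchDegree_le_one_of_forall {e : G.edgeSet} {v : V} (hv : v ∈ (e : Set V))
    (h : ∀ C : G.Walk, C.IsCycle → (v, (e : Set V)) ∉ C.incidences) : branchDegree v e ≤ 1 := by
  refine (card_le_card (t := {e}) fun f hf => mem_singleton.2 ?_).trans (card_singleton e).le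
  by_contra hne
  obtain ⟨hf1, hf2⟩ := mem_filter.1 hf
  obtain ⟨C, hC, -, h2⟩ := exists_isCycle_of_reachable hne hf2 hv (mem_branch.1 hf1)
  exact h C hC h2

/-- Each further edge of the branch at `v` closes a cycle through `e`. All these cycles coincide
with `C`, which has at most two edges at `v`. -/
theorem IsHypercactus.branchDegree_le_two (hG : G.IsHypercactus k) (hk : 2 ≤ k) {e : G.edgeSet}
    {v : V} (hv : v ∈ (e : Set V)) {C : G.Walk} (hC : C.IsCycle)
    (hCv : (v, (e : Set V)) ∈ C.incidences) : branchDegree v e ≤ 2 := by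
  refine le_trans ?_ (hC.ncard_edges_le_two v)
  rw [branchDegree, ← Set.ncard_coe_finset,
    ← Set.ncard_image_of_injective _ Subtype.val_injective]
  refine Set.ncard_le_ncard ?_ (G.finite_edgeSet.subset ?_)
  · rintro _ ⟨f, hf, rfl⟩
    obtain ⟨hf1, hf2⟩ := mem_filter.1 (mem_coe.1 hf)
    by_cases hne : f = e
    · rw [hne]
      exact hCv
    · obtain ⟨C', hC', h1, h2⟩ := exists_isCycle_of_reachable hne hf2 hv (mem_branch.1 hf1)
      obtain ⟨-, i, hi⟩ := Walk.exists_of_mem_incidences hCv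
      obtain ⟨-, j, hj⟩ := Walk.exists_of_mem_incidences h2
      rw [← hG.incidences_eq hk hC' hC (hj.trans hi.symm)]
      exact h1
  · intro f hf
    obtain ⟨-, i, rfl⟩ := Walk.exists_of_mem_incidences (show (v, f) ∈ C.incidences from hf)
    exact C.edge_mem i

theorem Walk.IsCycle.card_verts_filter {C : G.Walk} (hC : C.IsCycle) {e : G.edgeSet}
    {i : Fin C.length} (hi : C.edge i = e) :
    #((verts e).filter fun v : G.vertexSet => ((v : V), (e : Set V)) ∈ C.incidences) = 2 := by
  have h : ((verts e).filter fun v : G.vertexSet => ((v : V), (e : Set V)) ∈ C.incidences) =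
      {⟨C.vert i.castSucc, C.vert_mem _⟩, ⟨C.vert i.succ, C.vert_mem _⟩} := by
    ext v
    rw [mem_filter, ← hi, Walk.mem_incidences_edge_iff hC, mem_verts, ← hi, mem_insert,
      mem_singleton, Subtype.ext_iff, Subtype.ext_iff]
    refine and_iff_right_of_imp ?_
    rintro (h | h) <;> rw [h]
    · exact C.left_mem i
    · exact C.right_mem i
  rw [h, card_pair]
  exact fun h => C.vert_ne i (congrArg Subtype.val h)

section Weights

variable {a b : ℝ} {w : G.edgeSet → ℝ}

/-- The block of `e` is `{e}` and all branch degrees are 1. With `D = b` and `η = 1 / b ^ (k - 1)`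
the calibration reads `b ^ k * (η / D) = 1`. -/
theorem one_le_prod_of_not_onCycle (hG : G.IsHypercactus k) (hk : 2 ≤ k) (ha : 0 ≤ a)
    (hab : a < b) {e : G.edgeSet} (hw : ∀ f, 0 < w f) (hwe : a + 1 / b ^ (k - 1) ≤ w e)
    (hL : ∑ f, w f = a + b)
    (hcyc : ∀ C : G.Walk, C.IsCycle → ¬∃ i, C.edge i = e) :
    (∀ v ∈ verts e, 0 < (∑ f ∈ branch (v : V) e, w f) / branchDegree (v : V) e - a) ∧
    1 ≤ ∏ v ∈ verts e, ((∑ f ∈ branch (v : V) e, w f) / branchDegree (v : V) e - a) ∧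
    (∏ v ∈ verts e, ((∑ f ∈ branch (v : V) e, w f) / branchDegree (v : V) e - a) ≤ 1 →
      IsTight e) := by
  have hb : 0 < b := ha.trans_lt hab
  have hsplit := sum_add_sum_compl ({e} : Finset G.edgeSet) w
  rw [sum_singleton] at hsplit
  have hdeg : ∀ v ∈ verts e, branchDegree (v : V) e ≤
      if v ∈ (∅ : Finset G.vertexSet) then 2 else 1 := fun v hv => by
    rw [if_neg (notMem_empty v)]
    exact branchDegree_le_one_of_forall (mem_verts.1 hv) fun C hC h =>
      hcyc C hC (Walk.exists_of_mem_incidences h).2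
  obtain ⟨h1, h2, h3⟩ := one_le_prod_branch hG.connected (hG.uniform.nonempty hk) hw ha hab hL
    (e := e) (s := {e}) (T := ∅) hb (show 0 < 1 / b ^ (k - 1) by positivity)
    (fun f hf v _ => by rw [mem_singleton.1 hf]; exact self_mem_branch _ e) hdeg
    le_rfl (fun v _ hv => absurd hv (notMem_empty v)) (by linarith)
    (by
      simp only [notMem_empty, if_false, prod_const, hG.uniform.card_verts]
      obtain ⟨n, rfl⟩ : ∃ n, k = n + 1 := ⟨k - 1, by omega⟩
      rw [Nat.add_sub_cancel]
      field_simp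
      ring)
  refine ⟨h1, h2, fun h => ?_⟩
  obtain ⟨-, h4, h5⟩ := h3 h
  exact ⟨h5, fun f hf _ => h4 f (by simpa using hf), fun C hC hCe => absurd hCe (hcyc C hC)⟩

/-- The block is the cycle, and only its two vertices on `e` may have branch degree 2. With `D = b -
a` the calibration reads `b ^ (k - 2) * ((b - a) / 2) ^ 2 * (η / D) = 1`, so `η = 4 / (b ^ (k - 2) *
(b - a))`. -/
theorem one_le_prod_of_onCycle (hG : G.IsHypercactus k) (hk : 2 ≤ k) (ha : 0 ≤ a)
    (hab : a < b) {e : G.edgeSet} (hw : ∀ f, 0 < w f) {C : G.Walk} (hC : C.IsCycle)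
    {i : Fin C.length} (hi : C.edge i = e)
    (hwC : 2 * a + 4 / (b ^ (k - 2) * (b - a)) ≤ ∑ f ∈ cycleEdges C.incidences, w f)
    (hwC' : ∑ f ∈ cycleEdges C.incidences, w f = 2 * a + 4 / (b ^ (k - 2) * (b - a)) →
      C.length = 2) (hL : ∑ f, w f = a + b) :
    (∀ v ∈ verts e, 0 < (∑ f ∈ branch (v : V) e, w f) / branchDegree (v : V) e - a) ∧
    1 ≤ ∏ v ∈ verts e, ((∑ f ∈ branch (v : V) e, w f) / branchDegree (v : V) e - a) ∧
    (∏ v ∈ verts e, ((∑ f ∈ branch (v : V) e, w f) / branchDegree (v : V) e - a) ≤ 1 →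
      IsTight e) := by
  have hb : 0 < b := ha.trans_lt hab
  have hba : 0 < b - a := sub_pos.2 hab
  set T := (verts e).filter fun v : G.vertexSet => ((v : V), (e : Set V)) ∈ C.incidences with hT
  have hcard : #T = 2 := hC.card_verts_filter hi
  have hsplit := sum_add_sum_compl (cycleEdges C.incidences) w
  have hdeg : ∀ v ∈ verts e, branchDegree (v : V) e ≤ if v ∈ T then 2 else 1 := fun v hv => by
    split_ifs with h
    · exact hG.branchDegree_le_two hk (mem_verts.1 hv) hC (mem_filter.1 h).2
    · refine branchDegree_le_one_of_forall (mem_verts.1 hv) fun C' hC' h' => h ?_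
      obtain ⟨-, j, hj⟩ := Walk.exists_of_mem_incidences h'
      rw [hG.incidences_eq hk hC' hC (hj.trans hi.symm)] at h'
      exact mem_filter.2 ⟨hv, h'⟩
  obtain ⟨h1, h2, h3⟩ := one_le_prod_branch hG.connected (hG.uniform.nonempty hk) hw ha hab hL
    (e := e) (s := cycleEdges C.incidences) (T := T) hba
    (show 0 < 4 / (b ^ (k - 2) * (b - a)) by positivity)
    (fun f hf v _ => by
      obtain ⟨j, hj⟩ := mem_cycleEdges.1 hf
      have := hC.reachable v j i
      simp only [hi, hj] at this
      exact mem_branch.2 this) hdeg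
    (by linarith) (fun _ _ _ => le_rfl) (by linarith)
    (by
      rw [prod_ite, prod_const, prod_const, filter_mem_eq_inter,
        inter_eq_right.2 (filter_subset _ _), hcard, filter_not, filter_mem_eq_inter,
        inter_eq_right.2 (filter_subset _ _), card_sdiff_of_subset (filter_subset _ _), hcard,
        hG.uniform.card_verts]
      field_simp
      norm_num)
  refine ⟨h1, h2, fun h => ?_⟩
  obtain ⟨h6, h4, h5⟩ := h3 h
  refine ⟨h5, fun f hf hef => h4 f fun hfC => ?_, fun C' hC' hCe => ?_⟩
  · exact hef ⟨C, hC, ⟨i, hi⟩, mem_cycleEdges.1 hfC⟩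
  · obtain ⟨j, hj⟩ := hCe
    have hinc := hG.incidences_eq hk hC' hC (hj.trans hi.symm)
    rw [← hC'.card_cycleEdges, hinc, hC.card_cycleEdges]
    exact hwC' (by linarith)

end Weights

/-- The `α`-spectral radius of a hypercactus is at most `α + (1 - α) * b`, and in the case of equality
all edges are tight. -/
theorem IsHypercactus.alphaSpectralRadius_le (hG : G.IsHypercactus k) (hk : 2 ≤ k) {α b : ℝ}
    (hα₀ : 0 ≤ α) (hα₁ : α < 1) (hab : α / (1 - α) < b)
    (hL : (G.edgeSet.ncard : ℝ) * (α / (1 - α) + 1 / b ^ (k - 1)) +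
      (4 / (b ^ (k - 2) * (b - α / (1 - α))) - 2 / b ^ (k - 1)) * G.cycles.ncard =
        α / (1 - α) + b) :
    G.alphaSpectralRadius k α ≤ α + (1 - α) * b ∧
      (G.alphaSpectralRadius k α = α + (1 - α) * b → ∀ e : G.edgeSet, IsTight e) := by
  set a := α / (1 - α) with ha_def
  have hα : 0 < 1 - α := sub_pos.2 hα₁
  have ha : 0 ≤ a := by positivity
  have hb : 0 < b := ha.trans_lt hab
  have hba : 0 < b - a := sub_pos.2 hab
  -- `θ` is the mass required by an edge on no cycle, and `2 * θ + δ` is that required by a cycle.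
  -- Only a cycle of length 2 can meet the requirement without surplus.
  set θ := a + 1 / b ^ (k - 1) with hθ
  set δ := 4 / (b ^ (k - 2) * (b - a)) - 2 / b ^ (k - 1) with hδ_def
  have hθ0 : 0 < θ := by positivity
  have hδ : 0 ≤ δ := by
    rw [hδ_def, sub_nonneg]
    have e1 : b ^ (k - 1) = b ^ (k - 2) * b := by rw [← pow_succ]; congr 1; omega
    rw [e1]
    have : b ^ (k - 2) * (b - a) ≤ b ^ (k - 2) * b := by gcongr; linarith
    exact div_le_div₀ (by norm_num) (by norm_num) (by positivity) this
  set w : G.edgeSet → ℝ := edgeWeight θ δ with hw_def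
  have hwθ : ∀ f, θ ≤ w f := le_edgeWeight hδ
  have hw : ∀ f, 0 < w f := fun f => hθ0.trans_le (hwθ f)
  have hwL : ∑ f, w f = a + b := by rw [hw_def, sum_edgeWeight, hL]
  set B : G.vertexSet → G.edgeSet → ℝ := fun v e =>
    (∑ f ∈ branch (v : V) e, w f) / branchDegree (v : V) e - a with hB_def
  have hmain : ∀ e : G.edgeSet, (∀ v ∈ verts e, 0 < B v e) ∧ 1 ≤ ∏ v ∈ verts e, B v e ∧
      (∏ v ∈ verts e, B v e ≤ 1 → IsTight e) := by
    intro e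
    by_cases h : ∃ C : G.Walk, C.IsCycle ∧ ∃ i, C.edge i = e
    · obtain ⟨C, hC, i, hi⟩ := h
      have h1 := hC.le_sum_edgeWeight (θ := θ) hδ
      have h2 : (2 : ℝ) ≤ C.length := by exact_mod_cast hC.1
      have h3 : 2 * θ + δ = 2 * a + 4 / (b ^ (k - 2) * (b - a)) := by rw [hθ, hδ_def]; ring
      have h4 : 2 * θ ≤ C.length * θ := by gcongr
      refine one_le_prod_of_onCycle hG hk ha hab hw hC hi (by linarith) (fun heq => ?_) hwL
      have h5 : C.length * θ ≤ 2 * θ := by linarith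
      have h6 : (C.length : ℝ) ≤ 2 := le_of_mul_le_mul_right h5 hθ0
      exact le_antisymm (by exact_mod_cast h6) hC.1
    · push Not at h
      exact one_le_prod_of_not_onCycle hG hk ha hab hw (hwθ e) hwL
        fun C hC ⟨i, hi⟩ => h C hC i hi
  have hl : ∀ v : G.vertexSet, ∑ e : G.edgeSet with v ∈ verts e, (α + (1 - α) * B v e) ≤
      α + (1 - α) * b := by
    intro v
    have h1 := sum_branch_div_le w (fun f => (hw f).le) v
    have h2 : (1 - α) * a = α := by rw [ha_def]; field_simp
    have h3 : ∀ e ∈ ({e | v ∈ verts e} : Finset G.edgeSet), α + (1 - α) * B v e =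
        (1 - α) * ((∑ f ∈ branch (v : V) e, w f) / branchDegree (v : V) e) := by
      intro e _
      rw [hB_def, mul_sub, h2]
      ring
    rw [sum_congr rfl h3, ← mul_sum]
    have h4 := mul_le_mul_of_nonneg_left h1 hα.le
    rw [hwL] at h4
    linarith
  have hl0 : 0 < α + (1 - α) * b := by positivity
  refine ⟨hG.uniform.alphaSpectralRadius_le hk hα₀ hα₁ hl0.le (fun e => (hmain e).1) hl
    fun e => (hmain e).2.1, fun heq e => (hmain e).2.2 ?_⟩
  -- A product above 1 on a single edge would make the spectral bound strict.
  by_contra! hlt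
  exact (hG.uniform.alphaSpectralRadius_lt hG.connected hk hα₀ hα₁ hl0 (fun e => (hmain e).1) hl
    (fun e => (hmain e).2.1) ⟨e, hlt⟩).ne heq

/-- The parameter of the eigenvalue of the extremal hypergraph. -/
theorem exists_extremal_parameter {a : ℝ} (ha : 0 ≤ a) {k m r : ℕ} (hk : 2 ≤ k) (hm : 2 ≤ m)
    (hr : 2 * r ≤ m) : ∃ b, a < b ∧ (m : ℝ) * (a + 1 / b ^ (k - 1)) +
      (4 / (b ^ (k - 2) * (b - a)) - 2 / b ^ (k - 1)) * r = a + b := by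
  have hm' : (2 : ℝ) ≤ m := by exact_mod_cast hm
  have hr' : (2 : ℝ) * r ≤ m := by exact_mod_cast hr
  have hr0 : (0 : ℝ) ≤ r := Nat.cast_nonneg r
  -- Since `ε ≤ 1`, the point `b₀ = (m - 1) * a + ε` satisfies `ε ≤ 1 / b₀ ^ (k - 1)`. This gives `F
  -- b₀ ≥ (m - 1) * ε ≥ 0`, while `b₀` stays above `a`.
  set ε : ℝ := 1 / ((m - 1) * a + 1) ^ (k - 1) with hε
  have h1 : 1 ≤ (m - 1) * a + 1 := by nlinarith
  have hε0 : 0 < ε := by positivity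
  have hε1 : ε ≤ 1 := by
    rw [hε, div_le_one (by positivity)]
    exact one_le_pow₀ h1
  have ham : a ≤ (m - 1) * a := by nlinarith
  set b₀ := (m - 1) * a + ε with hb₀
  -- At `b₁` the reciprocal powers are at most 1, so the mass exceeds `m * a` by at most `m + 4 *
  -- r`.
  set b₁ := (m - 1) * a + (m + 4 * r) with hb₁
  have hab₀ : a < b₀ := by linarith
  have h01 : b₀ ≤ b₁ := by linarith
  let F : ℝ → ℝ := fun b => (m : ℝ) * (a + 1 / b ^ (k - 1)) +
      (4 / (b ^ (k - 2) * (b - a)) - 2 / b ^ (k - 1)) * r - (a + b)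
  have hcont : ContinuousOn F (Set.Icc b₀ b₁) := by
    have hne : ∀ b ∈ Set.Icc b₀ b₁, 0 < b ∧ 0 < b - a := fun b hb =>
      ⟨by linarith [hb.1], by linarith [hb.1]⟩
    have c1 : ContinuousOn (fun b : ℝ => b ^ (k - 1)) (Set.Icc b₀ b₁) := by fun_prop
    have c2 : ContinuousOn (fun b : ℝ => b ^ (k - 2) * (b - a)) (Set.Icc b₀ b₁) := by fun_prop
    have n1 : ∀ b ∈ Set.Icc b₀ b₁, b ^ (k - 1) ≠ 0 := fun b hb =>
      (pow_pos (hne b hb).1 _).ne'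
    have n2 : ∀ b ∈ Set.Icc b₀ b₁, b ^ (k - 2) * (b - a) ≠ 0 := fun b hb =>
      (mul_pos (pow_pos (hne b hb).1 _) (hne b hb).2).ne'
    exact ((continuousOn_const.mul (continuousOn_const.add (continuousOn_const.div c1 n1))).add
      (((continuousOn_const.div c2 n2).sub (continuousOn_const.div c1 n1)).mul
        continuousOn_const)).sub (continuousOn_const.add continuousOn_id)
  have hF0 : 0 ≤ F b₀ := by
    have hb0 : 0 < b₀ := by linarith
    have hp : ε ≤ 1 / b₀ ^ (k - 1) := by
      rw [hε]
      apply one_div_le_one_div_of_le (by positivity)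
      gcongr
      linarith
    have e1 : b₀ ^ (k - 1) = b₀ ^ (k - 2) * b₀ := by rw [← pow_succ]; congr 1; omega
    have hd : 2 / b₀ ^ (k - 1) ≤ 4 / (b₀ ^ (k - 2) * (b₀ - a)) := by
      rw [e1]
      have h3 : 0 < b₀ - a := by linarith
      have : b₀ ^ (k - 2) * (b₀ - a) ≤ b₀ ^ (k - 2) * b₀ := by gcongr; linarith
      exact div_le_div₀ (by norm_num) (by norm_num) (by positivity) this
    have h4 := mul_nonneg (sub_nonneg.2 hd) hr0
    have h5 : (m : ℝ) * ε ≤ m * (1 / b₀ ^ (k - 1)) := by gcongr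
    simp only [F]
    nlinarith
  have hF1 : F b₁ ≤ 0 := by
    have hb1 : 1 ≤ b₁ := by nlinarith
    have hb1' : 1 ≤ b₁ - a := by nlinarith
    have h2 : 1 / b₁ ^ (k - 1) ≤ 1 := by
      rw [div_le_one (by positivity)]
      exact one_le_pow₀ hb1
    have h3 : 4 / (b₁ ^ (k - 2) * (b₁ - a)) ≤ 4 := by
      refine div_le_self (by norm_num) ?_
      nlinarith [one_le_pow₀ hb1 (n := k - 2)]
    have h4 : 0 ≤ 2 / b₁ ^ (k - 1) := by positivity
    have h5 : (4 / (b₁ ^ (k - 2) * (b₁ - a)) - 2 / b₁ ^ (k - 1)) * r ≤ 4 * r := by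
      gcongr
      linarith
    have h6 : (m : ℝ) * (1 / b₁ ^ (k - 1)) ≤ m * 1 := by gcongr
    simp only [F]
    nlinarith
  obtain ⟨b, hb, hFb⟩ := intermediate_value_Icc' h01 hcont ⟨hF1, hF0⟩
  exact ⟨b, by linarith [hb.1], by simpa only [F, sub_eq_zero] using hFb⟩

end Hypergraph

/-! ### The equality case: hypercacti with only tight edges -/

namespace Hypergraph

open Classical

variable {V : Type*} {G : Hypergraph V} {k : ℕ}

theorem isIsomorphic_of_image {W : Type*} {H : Hypergraph W} {Φ : W → V}
    (hΦ : Function.Injective Φ) (hV : G.vertexSet = Φ '' H.vertexSet)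
    (hE : G.edgeSet = Set.image Φ '' H.edgeSet) : G.IsIsomorphic H := by
  let ψ : H.vertexSet ≃ G.vertexSet := (Equiv.Set.image Φ H.vertexSet hΦ).trans
    (Equiv.setCongr hV.symm)
  have hψ : ∀ u, (ψ u : V) = Φ u := fun u => rfl
  refine ⟨ψ.symm, fun e => ?_⟩
  have h1 : Subtype.val '' e = Φ '' (Subtype.val '' (ψ.symm '' e)) := by
    rw [← Set.image_comp, ← Set.image_comp]
    refine Set.image_congr fun u _ => ?_
    rw [Function.comp_apply, Function.comp_apply, ← hψ, Equiv.apply_symm_apply]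
  rw [h1, hE, (Set.image_injective.2 hΦ).mem_set_image]

theorem OnCommonCycle.symm {e f : G.edgeSet} (h : OnCommonCycle e f) : OnCommonCycle f e := by
  obtain ⟨C, hC, h1, h2⟩ := h
  exact ⟨C, hC, h2, h1⟩

theorem IsHypercactus.onCommonCycle_trans (hG : G.IsHypercactus k) (hk : 2 ≤ k)
    {e f g : G.edgeSet} (h : OnCommonCycle e f) (h' : OnCommonCycle f g) : OnCommonCycle e g := by
  obtain ⟨C, hC, h1, i, hi⟩ := h
  obtain ⟨C', hC', ⟨j, hj⟩, h2⟩ := h'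
  refine ⟨C, hC, h1, ?_⟩
  rwa [Walk.exists_edge_eq_iff, hG.incidences_eq hk hC hC' (hi.trans hj.symm),
    ← Walk.exists_edge_eq_iff]

theorem IsConnected.exists_mem_edge (hG : G.IsConnected) {w : V} (hw : w ∈ G.vertexSet)
    {e : Set V} (he : e ∈ G.edgeSet) (hwe : w ∈ e) {v : V} (hv : v ∈ G.vertexSet) :
    ∃ f ∈ G.edgeSet, v ∈ f := by
  by_cases hvw : v = w
  · exact ⟨e, he, hvw ▸ hwe⟩
  · obtain ⟨W, -, h0, h1⟩ := hG v hv w hw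
    have hlen : 0 < W.length := by
      by_contra! h
      have : (0 : Fin (W.length + 1)) = Fin.last W.length := Fin.ext (by simp; omega)
      rw [this, h1] at h0
      exact hvw h0.symm
    refine ⟨W.edge ⟨0, hlen⟩, W.edge_mem _, ?_⟩
    rw [← h0]
    exact W.left_mem ⟨0, hlen⟩

section Structure

variable [Fintype G.vertexSet]

theorem IsTight.notMem_branch {e f : G.edgeSet} (he : IsTight e) {y : V} (hy : y ∈ (e : Set V))
    (hyf : y ∈ (f : Set V)) (hne : f ≠ e) (h : ¬OnCommonCycle e f) : f ∉ branch y e := by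
  obtain ⟨v, hv, hfv⟩ := he.exists_notMem_branch f hne h
  have : y = v := by
    by_contra hyv
    exact hfv (mem_branch.2 (linkGraph_reachable_of_mem hyv hyf hy))
  rwa [this]

theorem IsTight.eq_of_mem {e f f' : G.edgeSet} (he : IsTight e) {y y' : V}
    (hy : y ∈ (e : Set V)) (hyf : y ∈ (f : Set V)) (hne : f ≠ e) (h : ¬OnCommonCycle e f)
    (hy' : y' ∈ (e : Set V)) (hyf' : y' ∈ (f' : Set V)) (hne' : f' ≠ e)
    (h' : ¬OnCommonCycle e f') : y = y' :=
  congrArg Subtype.val <| he.eq_of_notMem_branch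
    ⟨y, G.subset_vertexSet_of_mem_edgeSet' e.2 hy⟩ (mem_verts.2 hy)
    ⟨y', G.subset_vertexSet_of_mem_edgeSet' e.2 hy'⟩ (mem_verts.2 hy')
    f (he.notMem_branch hy hyf hne h) f' (he.notMem_branch hy' hyf' hne' h')

/-- If all edges are tight, then they have a common vertex `w`, and two edges that share a further
vertex lie on a common cycle. -/
theorem IsHypercactus.exists_center (hG : G.IsHypercactus k) (hk : 2 ≤ k)
    (hE : 2 ≤ G.edgeSet.ncard) (ht : ∀ e : G.edgeSet, IsTight e) :
    ∃ w, (∀ e : G.edgeSet, w ∈ (e : Set V)) ∧ ∀ e f : G.edgeSet, ∀ v, e ≠ f →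
      v ∈ (e : Set V) → v ∈ (f : Set V) → v ≠ w → OnCommonCycle e f := by
  have hne := hG.uniform.nonempty hk
  by_cases hadj : ∃ e f : G.edgeSet, ∃ w, w ∈ (e : Set V) ∧ w ∈ (f : Set V) ∧ f ≠ e ∧
      ¬OnCommonCycle e f
  · obtain ⟨e₀, f₀, w, he₀, hf₀, hne₀, h₀⟩ := hadj
    -- The property "contains `w` and meets there an edge on no common cycle with it" passes to
    -- intersecting edges. Tightness then makes `w` the only attachment vertex of each edge.
    have hw := hG.connected.forall_edge hne (P := fun e => w ∈ (e : Set V) ∧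
      ∃ f : G.edgeSet, w ∈ (f : Set V) ∧ f ≠ e ∧ ¬OnCommonCycle e f) (e := e₀)
      ⟨he₀, f₀, hf₀, hne₀, h₀⟩ ?_
    · refine ⟨w, fun e => (hw e).1, fun e f v hef he hf hvw => ?_⟩
      by_contra hcon
      exact hvw ((ht e).eq_of_mem he hf hef.symm hcon (hw e).1 (hw f).1 hef.symm hcon)
    · rintro e g y hye hyg ⟨hwe, f, hwf, hfe, hef⟩
      by_cases hge : g = e
      · rw [hge]
        exact ⟨hwe, f, hwf, hfe, hef⟩
      by_cases hc : OnCommonCycle e g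
      · have hgf : ¬OnCommonCycle g f := fun h => hef (hG.onCommonCycle_trans hk hc h)
        have hfg : f ≠ g := by
          rintro rfl
          exact hef hc
        obtain ⟨z, hz, hfz⟩ := (ht g).exists_notMem_branch f hfg hgf
        -- Otherwise `f` is linked to `e` through `w`, and `e` to `g` around their common cycle,
        -- both outside `z`, so `f` would not be cut off from `g` at `z`.
        have hzw : w = z := by
          by_contra hwz
          obtain ⟨C, hC, ⟨i, hi⟩, j, hj⟩ := hc
          have := hC.reachable z i j
          simp only [hi, hj] at this
          exact hfz (mem_branch.2 ((linkGraph_reachable_of_mem hwz hwf hwe).trans this))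
        exact ⟨hzw ▸ mem_verts.1 hz, f, hwf, hfg, hgf⟩
      · have hyw := (ht e).eq_of_mem hye hyg hge hc hwe hwf hfe hef
        rw [hyw] at hyg
        exact ⟨hyg, e, hwe, Ne.symm hge, fun h => hc h.symm⟩
  -- If intersecting edges always lie on a common cycle, then G is a single cycle. Tightness gives
  -- it length 2, and either of its linking vertices can serve as `w`.
  · push Not at hadj
    obtain ⟨e₀, e₁, h0, h1, h01⟩ := (Set.one_lt_ncard_iff G.finite_edgeSet).1
      (show 1 < G.edgeSet.ncard by omega)
    have hall := hG.connected.forall_edge hne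
      (P := fun e => e = (⟨e₀, h0⟩ : G.edgeSet) ∨ OnCommonCycle ⟨e₀, h0⟩ e) (e := ⟨e₀, h0⟩)
      (Or.inl rfl) (by
        intro f f' y hf hf' h
        by_cases hff : f' = f
        · rw [hff]
          exact h
        have h2 := hadj f f' y hf hf' hff
        rcases h with rfl | h
        · exact Or.inr h2
        · exact Or.inr (hG.onCommonCycle_trans hk h h2))
    rcases hall ⟨e₁, h1⟩ with h | h
    · exact absurd (congrArg Subtype.val h).symm h01
    obtain ⟨C, hC, ⟨i, hi⟩, hC1⟩ := h
    have hCall : ∀ e : G.edgeSet, ∃ j, C.edge j = e := by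
      intro e
      rcases hall e with rfl | ⟨C', hC', ⟨i', hi'⟩, h'⟩
      · exact ⟨i, hi⟩
      · rwa [Walk.exists_edge_eq_iff, hG.incidences_eq hk hC hC' (hi.trans hi'.symm),
          ← Walk.exists_edge_eq_iff]
    have hlen := (ht ⟨e₀, h0⟩).length_eq_two C hC ⟨i, hi⟩
    refine ⟨C.vert 0, fun e => ?_, fun e f v _ _ _ _ => ⟨C, hC, hCall e, hCall f⟩⟩
    obtain ⟨j, hj⟩ := hCall e
    rw [← hj]
    have hj2 := j.2
    rcases Nat.eq_zero_or_pos (j : ℕ) with h | h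
    · have := C.left_mem j
      rwa [show j.castSucc = 0 from Fin.ext h] at this
    · have := C.right_mem j
      rwa [show j.succ = Fin.last C.length from Fin.ext (by simp; omega), ← hC.2.2.1] at this

/-- A cycle of length `2` whose edges both contain `w`. -/
theorem IsHypercactus.exists_joint (hG : G.IsHypercactus k) (hk : 2 ≤ k) {C : G.Walk}
    (hC : C.IsCycle) (hlen : C.length = 2) {w : V} (hw : ∀ e : G.edgeSet, w ∈ (e : Set V)) :
    ∃ (E : Fin 2 → G.edgeSet) (x : V), Function.Injective E ∧ x ≠ w ∧
      (∀ s, x ∈ (E s : Set V)) ∧ (∀ v, (∀ s, v ∈ (E s : Set V)) → v = w ∨ v = x) ∧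
      ∀ f : G.edgeSet, f ∈ cycleEdges C.incidences ↔ ∃ s, E s = f := by
  let E : Fin 2 → G.edgeSet := fun s => ⟨C.edge (Fin.cast hlen.symm s), C.edge_mem _⟩
  have hE : Function.Injective E := fun s t hst =>
    Fin.cast_injective _ (hC.2.1 (congrArg Subtype.val hst))
  have hmem : ∀ f : G.edgeSet, f ∈ cycleEdges C.incidences ↔ ∃ s, E s = f := by
    intro f
    rw [mem_cycleEdges]
    constructor
    · rintro ⟨i, hi⟩
      exact ⟨Fin.cast hlen i, Subtype.ext hi⟩
    · rintro ⟨s, rfl⟩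
      exact ⟨_, rfl⟩
  have hcl : C.vert (Fin.succ (Fin.cast hlen.symm 1)) = C.vert (Fin.castSucc
      (Fin.cast hlen.symm 0)) := by
    rw [show Fin.succ (Fin.cast hlen.symm 1) = Fin.last C.length from Fin.ext (by simp [hlen]),
      ← hC.2.2.1]
    exact congrArg _ (Fin.ext rfl)
  have hmid : C.vert (Fin.succ (Fin.cast hlen.symm 0)) = C.vert (Fin.castSucc
      (Fin.cast hlen.symm 1)) := congrArg _ (Fin.ext rfl)
  set a := C.vert (Fin.castSucc (Fin.cast hlen.symm 0)) with ha
  set b := C.vert (Fin.castSucc (Fin.cast hlen.symm 1)) with hb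
  have hab : a ≠ b := by
    rw [← hmid]
    exact C.vert_ne _
  have haE : ∀ s, a ∈ (E s : Set V) := by
    intro s
    fin_cases s
    · exact C.left_mem _
    · rw [← hcl]
      exact C.right_mem _
  have hbE : ∀ s, b ∈ (E s : Set V) := by
    intro s
    fin_cases s
    · rw [← hmid]
      exact C.right_mem _
    · exact C.left_mem _
  -- Of `a` and `b`, one differs from `v` and links the two edges outside `v`. The cycle through `v`
  -- obtained this way must be `C`, so `v` is one of its two vertices.
  have hinter : ∀ v, (∀ s, v ∈ (E s : Set V)) → v = a ∨ v = b := by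
    intro v hv
    obtain ⟨x, hxv, hx⟩ : ∃ x, x ≠ v ∧ ∀ s, x ∈ (E s : Set V) := by
      by_cases h : a = v
      · exact ⟨b, fun h' => hab (h.trans h'.symm), hbE⟩
      · exact ⟨a, h, haE⟩
    obtain ⟨C', hC', h0, -⟩ := exists_isCycle_of_reachable (hE.ne (show (0 : Fin 2) ≠ 1 by simp))
      (hv 0) (hv 1) (linkGraph_reachable_of_mem hxv (hx 0) (hx 1))
    obtain ⟨-, j, hj⟩ := Walk.exists_of_mem_incidences h0
    rw [hG.incidences_eq hk hC' hC hj, Walk.mem_incidences_edge_iff hC, hmid] at h0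
    exact h0
  rcases hinter w fun s => hw _ with h | h
  · exact ⟨E, b, hE, fun h' => hab (h.symm.trans h'.symm), hbE,
      fun v hv => by rw [h]; exact hinter v hv, hmem⟩
  · exact ⟨E, a, hE, fun h' => hab (h'.trans h), haE,
      fun v hv => by rw [h]; exact (hinter v hv).symm, hmem⟩

/-- A hypercactus with `m` edges and `r` cycles all whose edges are tight is extremal. -/
theorem IsHypercactus.isIsomorphic_extremal (hG : G.IsHypercactus k) (hk : 2 ≤ k) {m r : ℕ}
    (hm : 2 ≤ m) (hGm : G.edgeSet.ncard = m) (hGr : G.cycles.ncard = r)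
    (ht : ∀ e : G.edgeSet, IsTight e) : G.IsIsomorphic (extremal m r k) := by
  obtain ⟨w, hw, hshare⟩ := hG.exists_center hk (hGm ▸ hm) ht
  have : Finite G.cycles := G.finite_cycles
  have σ : Fin r ≃ G.cycles := (Finite.equivFinOfCardEq (by rw [Nat.card_coe_set_eq, hGr])).symm
  have hσ : ∀ i, ∃ (E : Fin 2 → G.edgeSet) (x : V), Function.Injective E ∧ x ≠ w ∧
      (∀ s, x ∈ (E s : Set V)) ∧ (∀ v, (∀ s, v ∈ (E s : Set V)) → v = w ∨ v = x) ∧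
      ∀ f : G.edgeSet, f ∈ cycleEdges (σ i : Set (V × Set V)) ↔ ∃ s, E s = f := by
    intro i
    obtain ⟨C, hC, hCi⟩ := (σ i).2
    rw [← hCi]
    exact hG.exists_joint hk hC
      ((ht ⟨C.edge ⟨0, by have := hC.1; omega⟩, C.edge_mem _⟩).length_eq_two C hC ⟨_, rfl⟩) hw
  choose E x hEinj hxw hxE hxE' hEσ using hσ
  have hcyc : ∀ e f : G.edgeSet, OnCommonCycle e f → ∃ i s t, E i s = e ∧ E i t = f := by
    rintro e f ⟨C, hC, he, hf⟩
    obtain ⟨i, hi⟩ := σ.surjective ⟨C.incidences, C, hC, rfl⟩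
    have hi' : (σ i : Set (V × Set V)) = C.incidences := congrArg Subtype.val hi
    obtain ⟨s, hs⟩ := (hEσ i e).1 (hi' ▸ mem_cycleEdges.2 he)
    obtain ⟨t, ht⟩ := (hEσ i f).1 (hi' ▸ mem_cycleEdges.2 hf)
    exact ⟨i, s, t, hs, ht⟩
  have hE2 : ∀ i s j t, E i s = E j t → i = j ∧ s = t := by
    intro i s j t h
    have hij : i = j := by
      obtain ⟨C, hC, hCi⟩ := (σ i).2
      obtain ⟨D, hD, hDj⟩ := (σ j).2
      obtain ⟨a, ha⟩ := mem_cycleEdges.1 (hCi ▸ (hEσ i _).2 ⟨s, rfl⟩)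
      obtain ⟨b, hb⟩ := mem_cycleEdges.1 (hDj ▸ (hEσ j _).2 ⟨t, rfl⟩)
      have := hG.incidences_eq hk hC hD (ha.trans ((congrArg Subtype.val h).trans hb.symm))
      exact σ.injective (Subtype.ext (hCi.symm.trans (this.trans hDj)))
    subst hij
    exact ⟨rfl, hEinj i h⟩
  let pairs : Fin r × Fin 2 → G.edgeSet := fun p => E p.1 p.2
  have hpairs : Function.Injective pairs := fun p q h => Prod.ext (hE2 _ _ _ _ h).1 (hE2 _ _ _ _ h).2
  have hcard : Fintype.card {e : G.edgeSet // e ∉ Set.range pairs} = m - 2 * r := by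
    rw [Fintype.card_subtype_compl, ← Nat.card_eq_fintype_card, Nat.card_coe_set_eq, hGm]
    have : Fintype.card {e : G.edgeSet // e ∈ Set.range pairs} = 2 * r := by
      rw [← Nat.card_eq_fintype_card]
      change Nat.card (Set.range pairs) = 2 * r
      rw [Nat.card_range_of_injective hpairs]
      simp [mul_comm]
    rw [this]
  let τ : Fin (m - 2 * r) ≃ {e : G.edgeSet // e ∉ Set.range pairs} :=
    (Fintype.equivFinOfCardEq hcard).symm
  have hτE : ∀ j i s, E i s ≠ (τ j : G.edgeSet) := fun j i s h => (τ j).2 ⟨(i, s), h⟩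
  have hcover : ∀ e : G.edgeSet, (∃ i s, E i s = e) ∨ ∃ j, (τ j : G.edgeSet) = e := by
    intro e
    by_cases h : e ∈ Set.range pairs
    · obtain ⟨p, hp⟩ := h
      exact Or.inl ⟨p.1, p.2, hp⟩
    · exact Or.inr ⟨τ.symm ⟨e, h⟩, by rw [Equiv.apply_symm_apply]⟩
  -- Away from `w`, distinct edges meet only in the joint of a cycle that contains both. All
  -- injectivity claims about `Φ` below rest on this.
  have huniq : ∀ (e f : G.edgeSet) v, e ≠ f → v ∈ (e : Set V) → v ∈ (f : Set V) → v ≠ w →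
      ∃ i s t, E i s = e ∧ E i t = f ∧ v = x i := by
    intro e f v hef he hf hvw
    obtain ⟨i, s, t, hs, ht⟩ := hcyc e f (hshare e f v hef he hf hvw)
    refine ⟨i, s, t, hs, ht, (hxE' i v fun u => ?_).resolve_left hvw⟩
    have hst : s ≠ t := fun h => hef (by rw [← hs, ← ht, h])
    rcases (show u = s ∨ u = t by omega) with rfl | rfl
    · rw [hs]; exact he
    · rw [ht]; exact hf
  have hfin : ∀ e : G.edgeSet, (e : Set V).Finite := fun e =>
    Set.finite_of_ncard_pos (by rw [hG.uniform e e.2]; omega)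
  have hoc : ∀ i s, ∃ f : Fin (k - 2) → V, Function.Injective f ∧
      Set.range f = (E i s : Set V) \ {w, x i} := by
    intro i s
    have hc : ((E i s : Set V) \ {w, x i}).ncard = k - 2 := by
      rw [Set.ncard_sdiff (by
        rintro v (rfl | rfl)
        exacts [hw _, hxE i s]), hG.uniform _ (E i s).2, Set.ncard_pair (hxw i).symm]
    have : Finite ((E i s : Set V) \ {w, x i} : Set V) := (hfin (E i s)).sdiff
    have eq := (Finite.equivFinOfCardEq ((Nat.card_coe_set_eq _).trans hc)).symm
    exact ⟨fun t => eq t, Subtype.val_injective.comp eq.injective, by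
      rw [← Function.comp_def, EquivLike.range_comp, Subtype.range_coe]⟩
  have hpd : ∀ j, ∃ f : Fin (k - 1) → V, Function.Injective f ∧
      Set.range f = ((τ j : G.edgeSet) : Set V) \ {w} := by
    intro j
    have hc : (((τ j : G.edgeSet) : Set V) \ {w}).ncard = k - 1 := by
      rw [Set.ncard_sdiff (by
        rintro v rfl
        exact hw _), hG.uniform _ (τ j : G.edgeSet).2, Set.ncard_singleton]
    have : Finite (((τ j : G.edgeSet) : Set V) \ {w} : Set V) := (hfin (τ j)).sdiff
    have eq := (Finite.equivFinOfCardEq ((Nat.card_coe_set_eq _).trans hc)).symm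
    exact ⟨fun t => eq t, Subtype.val_injective.comp eq.injective, by
      rw [← Function.comp_def, EquivLike.range_comp, Subtype.range_coe]⟩
  choose oc hoc_inj hoc_range using hoc
  choose pd hpd_inj hpd_range using hpd
  have hoc_mem : ∀ i s t, oc i s t ∈ (E i s : Set V) ∧ oc i s t ≠ w ∧ oc i s t ≠ x i := by
    intro i s t
    have : oc i s t ∈ (E i s : Set V) \ {w, x i} := hoc_range i s ▸ ⟨t, rfl⟩
    simpa using this
  have hpd_mem : ∀ j t, pd j t ∈ ((τ j : G.edgeSet) : Set V) ∧ pd j t ≠ w := by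
    intro j t
    have : pd j t ∈ ((τ j : G.edgeSet) : Set V) \ {w} := hpd_range j ▸ ⟨t, rfl⟩
    simpa using this
  let Φ : ExtremalVertex m r k → V
    | .center => w
    | .joint i => x i
    | .onCycle i s t => oc i s t
    | .pendant j t => pd j t
  have hΦE : ∀ i s, Φ '' ({.center, .joint i} ∪ Set.range (ExtremalVertex.onCycle i s)) = E i s := by
    intro i s
    rw [Set.image_union, Set.image_pair, ← Set.range_comp]
    change {w, x i} ∪ Set.range (oc i s) = _
    rw [hoc_range]
    refine Set.union_sdiff_cancel ?_
    rintro v (rfl | rfl)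
    exacts [hw _, hxE i s]
  have hΦτ : ∀ j, Φ '' ({.center} ∪ Set.range (ExtremalVertex.pendant j)) = (τ j : G.edgeSet) := by
    intro j
    rw [Set.image_union, Set.image_singleton, ← Set.range_comp]
    change {w} ∪ Set.range (pd j) = _
    rw [hpd_range]
    refine Set.union_sdiff_cancel ?_
    rintro v rfl
    exact hw _
  have hedges : G.edgeSet = Set.image Φ '' (extremal m r k).edgeSet := by
    ext e
    constructor
    · intro he
      rcases hcover ⟨e, he⟩ with ⟨i, s, h⟩ | ⟨j, h⟩
      · exact ⟨_, Or.inl ⟨(i, s), rfl⟩, (hΦE i s).trans (congrArg Subtype.val h)⟩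
      · exact ⟨_, Or.inr ⟨j, rfl⟩, (hΦτ j).trans (congrArg Subtype.val h)⟩
    · rintro ⟨_, ⟨⟨i, s⟩, rfl⟩ | ⟨j, rfl⟩, rfl⟩
      · exact (hΦE i s).symm ▸ (E i s).2
      · exact (hΦτ j).symm ▸ (τ j : G.edgeSet).2
  have hxx : ∀ i j, x i = x j → i = j := by
    intro i j h
    by_contra hij
    obtain ⟨l, s, t, h1, h2, -⟩ := huniq (E i 0) (E j 0) (x i) (fun h' => hij (hE2 _ _ _ _ h').1)
      (hxE i 0) (h ▸ hxE j 0) (hxw i)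
    exact hij ((hE2 _ _ _ _ h1).1.symm.trans (hE2 _ _ _ _ h2).1)
  have hxoc : ∀ i j s t, x i ≠ oc j s t := by
    intro i j s t h
    obtain ⟨h1, h2, h3⟩ := hoc_mem j s t
    by_cases hij : i = j
    · exact h3 (h ▸ hij ▸ rfl)
    · obtain ⟨l, a, b, h4, h5, -⟩ := huniq (E i 0) (E j s) (x i)
        (fun h' => hij (hE2 _ _ _ _ h').1) (hxE i 0) (h ▸ h1) (hxw i)
      exact hij ((hE2 _ _ _ _ h4).1.symm.trans (hE2 _ _ _ _ h5).1)
  have hxpd : ∀ i j t, x i ≠ pd j t := by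
    intro i j t h
    obtain ⟨l, a, b, -, h5, -⟩ := huniq (E i 0) (τ j) (x i) (hτE j i 0) (hxE i 0)
      (h ▸ (hpd_mem j t).1) (hxw i)
    exact hτE _ _ _ h5
  have hocpd : ∀ i s t j u, oc i s t ≠ pd j u := by
    intro i s t j u h
    obtain ⟨l, a, b, -, h5, -⟩ := huniq (E i s) (τ j) (oc i s t) (hτE j i s) (hoc_mem i s t).1
      (h ▸ (hpd_mem j u).1) (hoc_mem i s t).2.1
    exact hτE _ _ _ h5
  have hococ : ∀ i s t i' s' t', oc i s t = oc i' s' t' → i = i' ∧ s = s' ∧ t = t' := by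
    intro i s t i' s' t' h
    by_cases hee : E i s = E i' s'
    · obtain ⟨rfl, rfl⟩ := hE2 _ _ _ _ hee
      exact ⟨rfl, rfl, hoc_inj i s h⟩
    · obtain ⟨l, a, b, h4, -, h6⟩ := huniq (E i s) (E i' s') (oc i s t) hee (hoc_mem i s t).1
        (h ▸ (hoc_mem i' s' t').1) (hoc_mem i s t).2.1
      exact absurd ((hE2 _ _ _ _ h4).1 ▸ h6) (hoc_mem i s t).2.2
  have hpdpd : ∀ j t j' t', pd j t = pd j' t' → j = j' ∧ t = t' := by
    intro j t j' t' h
    by_cases hee : (τ j : G.edgeSet) = τ j'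
    · obtain rfl := τ.injective (Subtype.ext hee)
      exact ⟨rfl, hpd_inj j h⟩
    · obtain ⟨l, a, b, -, h5, -⟩ := huniq (τ j) (τ j') (pd j t) hee (hpd_mem j t).1
        (h ▸ (hpd_mem j' t').1) (hpd_mem j t).2
      exact absurd h5 (hτE _ _ _)
  refine isIsomorphic_of_image (Φ := Φ) ?_ ?_ hedges
  · rintro (_ | i | ⟨i, s, t⟩ | ⟨j, t⟩) (_ | i' | ⟨i', s', t'⟩ | ⟨j', t'⟩) h
    · rfl
    · exact absurd h.symm (hxw i')
    · exact absurd h.symm (hoc_mem i' s' t').2.1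
    · exact absurd h.symm (hpd_mem j' t').2
    · exact absurd h (hxw i)
    · rw [hxx i i' h]
    · exact absurd h (hxoc _ _ _ _)
    · exact absurd h (hxpd _ _ _)
    · exact absurd h (hoc_mem i s t).2.1
    · exact absurd h.symm (hxoc _ _ _ _)
    · obtain ⟨rfl, rfl, rfl⟩ := hococ _ _ _ _ _ _ h
      rfl
    · exact absurd h (hocpd _ _ _ _ _)
    · exact absurd h (hpd_mem j t).2
    · exact absurd h.symm (hxpd _ _ _)
    · exact absurd h.symm (hocpd _ _ _ _ _)
    · obtain ⟨rfl, rfl⟩ := hpdpd _ _ _ _ h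
      rfl
  · ext v
    constructor
    · intro hv
      obtain ⟨e, he⟩ : G.edgeSet.Nonempty := Set.nonempty_of_ncard_ne_zero (by omega)
      obtain ⟨f, hf, hvf⟩ := hG.connected.exists_mem_edge
        (G.subset_vertexSet_of_mem_edgeSet' he (hw ⟨e, he⟩)) he (hw ⟨e, he⟩) hv
      rw [hedges] at hf
      obtain ⟨e', -, rfl⟩ := hf
      obtain ⟨u, -, rfl⟩ := hvf
      exact ⟨u, Set.mem_univ u, rfl⟩
    · rintro ⟨u, -, rfl⟩
      rcases u with _ | i | ⟨i, s, t⟩ | ⟨j, t⟩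
      · obtain ⟨e, he⟩ : G.edgeSet.Nonempty := Set.nonempty_of_ncard_ne_zero (by omega)
        exact G.subset_vertexSet_of_mem_edgeSet' he (hw ⟨e, he⟩)
      · exact G.subset_vertexSet_of_mem_edgeSet' (E i 0).2 (hxE i 0)
      · exact G.subset_vertexSet_of_mem_edgeSet' (E i s).2 (hoc_mem i s t).1
      · exact G.subset_vertexSet_of_mem_edgeSet' (τ j : G.edgeSet).2 (hpd_mem j t).1

end Structure

end Hypergraph

namespace Hypergraph

open Classical

/-! ### The extremal hypergraph -/

section Extremal

variable {m r k : ℕ}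

/-- The vertices of the edges of `extremal m r k`, where the edges are indexed by the cycles with
a choice of one of its two edges, and by the pendant edges. -/
noncomputable def extremalEdge (m r k : ℕ) :
    (Fin r × Fin 2) ⊕ Fin (m - 2 * r) → Finset (ExtremalVertex m r k)
  | .inl p => insert .center (insert (.joint p.1) (univ.image (ExtremalVertex.onCycle p.1 p.2)))
  | .inr j => insert .center (univ.image (ExtremalVertex.pendant j))

theorem edgeSet_extremal : (extremal m r k).edgeSet =
    Set.range fun i => (extremalEdge m r k i : Set (ExtremalVertex m r k)) := by
  ext e
  constructor
  · rintro (⟨p, rfl⟩ | ⟨j, rfl⟩)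
    · refine ⟨.inl p, ?_⟩
      ext v
      simp [extremalEdge, or_assoc]
    · refine ⟨.inr j, ?_⟩
      ext v
      simp [extremalEdge]
  · rintro ⟨p | j, rfl⟩
    · refine Or.inl ⟨p, ?_⟩
      ext v
      simp [extremalEdge, or_assoc]
    · refine Or.inr ⟨j, ?_⟩
      ext v
      simp [extremalEdge]

theorem prod_extremalEdge_inl {M : Type*} [CommMonoid M] (y : ExtremalVertex m r k → M)
    (p : Fin r × Fin 2) : ∏ v ∈ extremalEdge m r k (.inl p), y v =
      y .center * (y (.joint p.1) * ∏ t, y (.onCycle p.1 p.2 t)) := by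
  rw [extremalEdge, prod_insert (by simp), prod_insert (by simp),
    prod_image fun a _ b _ h => by simpa using h]

theorem prod_extremalEdge_inr {M : Type*} [CommMonoid M] (y : ExtremalVertex m r k → M)
    (j : Fin (m - 2 * r)) : ∏ v ∈ extremalEdge m r k (.inr j), y v =
      y .center * ∏ t, y (.pendant j t) := by
  rw [extremalEdge, prod_insert (by simp), prod_image fun a _ b _ h => by simpa using h]

theorem card_extremalEdge (hk : 2 ≤ k) (i : (Fin r × Fin 2) ⊕ Fin (m - 2 * r)) :
    #(extremalEdge m r k i) = k := by
  rcases i with p | j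
  · rw [extremalEdge, card_insert_of_notMem (by simp), card_insert_of_notMem (by simp),
      card_image_of_injective _ (fun a b h => by simpa using h), card_univ, Fintype.card_fin]
    omega
  · rw [extremalEdge, card_insert_of_notMem (by simp),
      card_image_of_injective _ (fun a b h => by simpa using h), card_univ, Fintype.card_fin]
    omega

/-- The two edges of a cycle are told apart by a vertex that lies on just one of them, which
requires `k ≥ 3`. -/
theorem extremalEdge_injective (hk : 2 ≤ k) (hkr : 1 ≤ r → 3 ≤ k) :
    Function.Injective (extremalEdge m r k) := by
  rintro (p | j) (q | l) h
  · have hk3 := hkr (Nat.succ_le_of_lt (Fin.pos p.1))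
    have : ExtremalVertex.onCycle p.1 p.2 (⟨0, by omega⟩ : Fin (k - 2)) ∈
        extremalEdge m r k (.inl q) := h ▸ by simp [extremalEdge]
    simp only [extremalEdge, mem_insert, reduceCtorEq, mem_image, mem_univ, true_and, false_or,
      ExtremalVertex.onCycle.injEq] at this
    obtain ⟨t, h1, h2, -⟩ := this
    rw [Prod.ext h1 h2]
  · have : ExtremalVertex.joint p.1 ∈ extremalEdge m r k (.inr l) := h ▸ by simp [extremalEdge]
    simp [extremalEdge] at this
  · have : ExtremalVertex.joint q.1 ∈ extremalEdge m r k (.inr j) := h ▸ by simp [extremalEdge]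
    simp [extremalEdge] at this
  · have : ExtremalVertex.pendant j (⟨0, by omega⟩ : Fin (k - 1)) ∈
        extremalEdge m r k (.inr l) := h ▸ by simp [extremalEdge]
    simp only [extremalEdge, mem_insert, reduceCtorEq, mem_image, mem_univ, true_and, false_or,
      ExtremalVertex.pendant.injEq] at this
    obtain ⟨t, h1, -⟩ := this
    rw [h1]

theorem isUniform_extremal (hk : 2 ≤ k) : (extremal m r k).IsUniform k := by
  intro e he
  rw [edgeSet_extremal] at he
  obtain ⟨i, rfl⟩ := he
  rw [Set.ncard_coe_finset, card_extremalEdge hk]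

theorem sum_edgeSet_extremal (hk : 2 ≤ k) (hkr : 1 ≤ r → 3 ≤ k)
    (F : Finset (ExtremalVertex m r k) → ℝ) (v : (extremal m r k).vertexSet) :
    ∑ e : (extremal m r k).edgeSet with v ∈ verts e, F ((verts e).map (Function.Embedding.subtype _))
      = ∑ i with (v : ExtremalVertex m r k) ∈ extremalEdge m r k i, F (extremalEdge m r k i) := by
  rw [sum_filter, sum_filter]
  symm
  let ψ : (Fin r × Fin 2) ⊕ Fin (m - 2 * r) → (extremal m r k).edgeSet := fun i =>
    ⟨extremalEdge m r k i, by rw [edgeSet_extremal]; exact ⟨i, rfl⟩⟩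
  have hψ : Function.Bijective ψ := by
    constructor
    · intro i j hij
      exact extremalEdge_injective hk hkr (coe_injective (congrArg Subtype.val hij))
    · rintro ⟨e, he⟩
      have he' := he
      rw [edgeSet_extremal] at he'
      obtain ⟨i, hi⟩ := he'
      exact ⟨i, Subtype.ext hi⟩
  refine Fintype.sum_bijective ψ hψ _ _ fun i => ?_
  have h1 : (verts (ψ i)).map (Function.Embedding.subtype _) = extremalEdge m r k i := by
    rw [← coe_inj, coe_map]
    exact coe_image_verts (ψ i)
  have h2 : v ∈ verts (ψ i) ↔ (v : ExtremalVertex m r k) ∈ extremalEdge m r k i := by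
    rw [mem_verts]
    exact mem_coe
  rw [h1]
  simp only [h2]

theorem sum_filter_extremalEdge (F : (Fin r × Fin 2) ⊕ Fin (m - 2 * r) → ℝ)
    (v : ExtremalVertex m r k) :
    ∑ i with v ∈ extremalEdge m r k i, F i =
      match v with
      | .center => ∑ i, ∑ s, F (.inl (i, s)) + ∑ j, F (.inr j)
      | .joint i => ∑ s, F (.inl (i, s))
      | .onCycle i s _ => F (.inl (i, s))
      | .pendant j _ => F (.inr j) := by
  rw [sum_filter, Fintype.sum_sum_type, Fintype.sum_prod_type]
  rcases v with _ | i | ⟨i, s, t⟩ | ⟨j, t⟩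
  · simp [extremalEdge]
  · simp only [extremalEdge, mem_insert, reduceCtorEq, mem_image, mem_univ, true_and, false_or,
      ExtremalVertex.joint.injEq, exists_false, or_false, if_false, sum_const_zero, add_zero]
    rw [sum_eq_single i]
    · simp
    · intro j _ hj
      simp [hj.symm]
    · simp
  · simp only [extremalEdge, mem_insert, reduceCtorEq, mem_image, mem_univ, true_and, false_or,
      ExtremalVertex.onCycle.injEq, exists_false, if_false, sum_const_zero, add_zero]
    rw [sum_eq_single i, sum_eq_single s]
    · simp
    · intro u _ hu
      simp [hu]
    · simp
    · intro j _ hj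
      simp [hj]
    · simp
  · simp only [extremalEdge, mem_insert, reduceCtorEq, mem_image, mem_univ, true_and, false_or,
      ExtremalVertex.pendant.injEq, exists_false, if_false, sum_const_zero, zero_add]
    rw [sum_eq_single j]
    · simp
    · intro l _ hl
      simp [hl]
    · simp

/-- A positive vector that satisfies the eigenvalue equations of the extremal hypergraph. -/
theorem le_alphaSpectralRadius_extremal (hk : 2 ≤ k) (hkr : 1 ≤ r → 3 ≤ k) (hr : 2 * r ≤ m)
    {α b : ℝ} (hα₀ : 0 ≤ α) (hα₁ : α < 1) (hab : α / (1 - α) < b)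
    (hL : (m : ℝ) * (α / (1 - α) + 1 / b ^ (k - 1)) +
      (4 / (b ^ (k - 2) * (b - α / (1 - α))) - 2 / b ^ (k - 1)) * r = α / (1 - α) + b) :
    α + (1 - α) * b ≤ (extremal m r k).alphaSpectralRadius k α := by
  have hα : 0 < 1 - α := sub_pos.2 hα₁
  set a := α / (1 - α) with ha_def
  have ha : 0 ≤ a := by positivity
  have hb : 0 < b := ha.trans_lt hab
  have hba : 0 < b - a := sub_pos.2 hab
  have hαa : α = (1 - α) * a := by rw [ha_def]; field_simp
  set c := (b - a) / 2 with hc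
  have hc0 : 0 < c := by positivity
  set q : ℝ := (b / c) ^ (1 / (k : ℝ)) with hq
  have hq0 : 0 < q := by positivity
  have hqk : q ^ k = b / c := by
    rw [hq, one_div, Real.rpow_inv_natCast_pow (by positivity) (by omega)]
  obtain ⟨n, rfl⟩ : ∃ n, k = n + 2 := ⟨k - 2, by omega⟩
  simp only [Nat.add_sub_cancel, show n + 2 - 1 = n + 1 by omega] at hL
  let y : ExtremalVertex m r (n + 2) → ℝ
    | .center => 1
    | .joint _ => q ^ 2 / b
    | .onCycle _ _ _ => q / b
    | .pendant _ _ => 1 / b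
  have hy : ∀ v, 0 < y v := by
    rintro (_ | i | ⟨i, s, t⟩ | ⟨j, t⟩) <;> simp only [y] <;> positivity
  let P : (Fin r × Fin 2) ⊕ Fin (m - 2 * r) → ℝ := fun i =>
    ∏ v ∈ extremalEdge m r (n + 2) i, y v
  have hPl : ∀ p, P (.inl p) = q ^ (n + 2) / b ^ (n + 1) := by
    intro p
    simp only [P, prod_extremalEdge_inl, y, prod_const, card_univ, Fintype.card_fin,
      Nat.add_sub_cancel, div_pow]
    field_simp
    ring
  have hPr : ∀ j, P (.inr j) = 1 / b ^ (n + 1) := by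
    intro j
    simp only [P, prod_extremalEdge_inr, y, prod_const, card_univ, Fintype.card_fin, one_mul, div_pow,
      one_pow]
    rfl
  refine (isUniform_extremal hk).le_alphaSpectralRadius hk (by positivity)
    (x := fun v => y v) (fun h => ?_) fun v => ?_
  · exact (hy .center).ne' (congrFun h ⟨.center, Set.mem_univ _⟩)
  have h1 := sum_edgeSet_extremal hk hkr (fun e => α * y v ^ (n + 2) + (1 - α) * ∏ u ∈ e, y u) v
  have h2 := sum_filter_extremalEdge (fun i => α * y v ^ (n + 2) + (1 - α) * P i) v.1
  have h3 : ∑ e : (extremal m r (n + 2)).edgeSet with v ∈ verts e, (α * y v ^ (n + 2) +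
      (1 - α) * ∏ u ∈ (verts e).map (Function.Embedding.subtype _), y u) =
      (α * (#{e : (extremal m r (n + 2)).edgeSet | v ∈ verts e} : ℝ) * y v ^ (n + 2 - 1) +
      (1 - α) * ∑ e : (extremal m r (n + 2)).edgeSet with v ∈ verts e,
        ∏ u ∈ (verts e).erase v, y u) * y v := by
    rw [sum_add_distrib, sum_const, nsmul_eq_mul, add_mul, mul_assoc (1 - α), sum_mul, ← mul_sum]
    congr 1
    · rw [show n + 2 - 1 = n + 1 by omega]
      ring
    · congr 1
      refine sum_congr rfl fun e he => ?_
      rw [prod_map]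
      exact (prod_erase_mul (verts e) (fun u : (extremal m r (n + 2)).vertexSet => y u)
        (mem_filter.1 he).2).symm
  -- Multiplying the equation at `v` by `y v` turns the products with `v` erased into full edge
  -- products, which depend only on the type of the edge.
  refine mul_right_cancel₀ (hy v).ne' ?_
  rw [← h3, h1]
  refine h2.trans ?_
  rw [mul_assoc, ← pow_succ, show n + 2 - 1 + 1 = n + 2 by omega]
  have hr' : ((m - 2 * r : ℕ) : ℝ) = m - 2 * r := by
    rw [Nat.cast_sub hr]
    push_cast
    ring
  have hbc : b / c / b ^ (n + 1) = 2 / (b ^ n * (b - a)) := by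
    rw [hc]
    field_simp
    ring
  rcases v with ⟨_ | i | ⟨i, s, t⟩ | ⟨j, t⟩, -⟩
  · simp only [hPl, hPr, y, sum_const, card_univ, Fintype.card_fin, nsmul_eq_mul, hqk, hr', hbc,
      one_pow, mul_one]
    push_cast
    linear_combination (1 - α) * hL + (m - 1) * hαa
  · simp only [hPl, y, sum_const, card_univ, Fintype.card_fin, nsmul_eq_mul, hqk]
    have h4 : b / c / b ^ (n + 1) = c * (q ^ 2 / b) ^ (n + 2) := by
      rw [div_pow, ← pow_mul, mul_comm 2, pow_mul, hqk]
      field_simp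
      ring
    rw [h4]
    push_cast
    linear_combination (q ^ 2 / b) ^ (n + 2) * (hαa + 2 * (1 - α) * hc)
  · simp only [hPl, y]
    have h4 : q ^ (n + 2) / b ^ (n + 1) = b * (q / b) ^ (n + 2) := by
      rw [div_pow]
      field_simp
      ring
    rw [h4]
    ring
  · simp only [hPr, y]
    have h4 : 1 / b ^ (n + 1) = b * (1 / b) ^ (n + 2) := by
      rw [div_pow]
      field_simp
      ring
    rw [h4]
    ring

end Extremal

end Hypergraph

theorem mainTheorem1 {V : Type*} (G : Hypergraph V) [Fintype G.vertexSet] (k m r : ℕ) (α : ℝ)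
    (hk : 2 ≤ k) (hm : 2 ≤ m) (hr : r ≤ m / 2) (hkr : 1 ≤ r → 3 ≤ k)
    (hG : G.IsHypercactus k) (hGm : G.edgeSet.ncard = m) (hGr : G.cycles.ncard = r)
    (hα₀ : 0 ≤ α) (hα₁ : α < 1) :
    G.alphaSpectralRadius k α ≤ (Hypergraph.extremal m r k).alphaSpectralRadius k α ∧
      (G.alphaSpectralRadius k α = (Hypergraph.extremal m r k).alphaSpectralRadius k α ↔
        G.IsIsomorphic (Hypergraph.extremal m r k)) := by
  have hr2 : 2 * r ≤ m := by omega
  obtain ⟨b, hab, hL⟩ := Hypergraph.exists_extremal_parameter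
    (div_nonneg hα₀ (sub_pos.2 hα₁).le) hk hm hr2
  have hH := Hypergraph.le_alphaSpectralRadius_extremal hk hkr hr2 hα₀ hα₁ hab hL
  obtain ⟨hle, htight⟩ := hG.alphaSpectralRadius_le hk hα₀ hα₁ hab (by rw [hGm, hGr, hL])
  refine ⟨hle.trans hH, fun h => ?_, fun h => h.alphaSpectralRadius_eq k α⟩
  exact hG.isIsomorphic_extremal hk hm hGm hGr (htight (le_antisymm hle (h ▸ hH)))
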